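/- **Problem and model.** In SetDisjointness a family of finite sets $S_1,\dots,S_m$ of total size $N=\sum_{i=1}^m|S_i|$, with $m\le N$, is preprocessed so that, given a pair $(i,j)$, one can decide whether $S_i\cap S_j=\emptyset$. A data structure consists of an arbitrary preprocessing map (without bound on its resources), which turns the family into a list of words, and of a fixed deterministic word-RAM query program, which has read access to this list and a scratch memory that is initially zero; words have $O(\log N)$ bits. Its space is the number of words in the list, and its query time is the largest number of steps of the query program over all families of the given size and all pairs $(i,j)$. **Strong SetDisjointness Conjecture.** Every data structure for SetDisjointness with query time $T=T(N)$ uses $S=\tilde\Omega(N^2/T^2)$ space, that is, there are $c>0$ and $k\in\mathbb N$ with $S(N)\ge c\,\frac{N^2}{T(N)^2\log^k N}$ for all sufficiently large $N$. **Corollary.** Assume the Strong SetDisjointness Conjecture. Let $\epsilon,\delta>0$ and let $u=u(N)$ be any integer function with $N^\delta\le u(N)\le N$ for all $N$. Consider any data structure that solves SetDisjointness on all families of sets $S_1,\dots,S_m\subseteq[u]$, where $N=\sum_{i=1}^m|S_i|$, $m\le N$, and $$m\in\left[\frac{N}{u^{1/2}},\ \frac{N}{u^{1/2-\epsilon}}\right],$$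 with space $S(N,m)$ and query time $T(N,m)$ (nothing is required for other values of $m$). Then it must either use $\Omega(m^{2-o(1)})$ space or have $\Omega(u^{1/2-o(1)})$ query time. Precisely, there is a function $\eta(N)\to0$ such that for every sufficiently large $N$ there is an $m\le N$ in the above range with $$S(N,m)\ge m^{2-\eta(N)}\quad\text{or}\quad T(N,m)\ge u(N)^{1/2-\eta(N)}.$$ -/

import Mathlib

open Filter Topology

/-! ## A word RAM

A query algorithm is a single program, independent of the input size, in a structured random access
language. It has registers, a scratch memory that is initially zero, and read access to the stored
data structure, a list of words. Every value that is produced must be a word, that is, smaller than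
a bound `W`, which below is a fixed power of the input size, so a word has `O(log N)` bits. Each
elementary instruction and each test of a branch or a loop takes one step. -/

namespace WordRAM

/-- The arithmetic, bitwise and comparison operations of the machine. -/
inductive Op
  | add | sub | mul | div | mod | land | lor | xor | shl | shr | lt | eq

/-- The value of an operation. Subtraction is truncated at zero, division by zero gives zero, and
comparisons give `0` or `1`. -/
def Op.eval : Op → ℕ → ℕ → ℕ
  | .add, a, b => a + b
  | .sub, a, b => a - b
  | .mul, a, b => a * b
  | .div, a, b => a / b
  | .mod, a, b => a % b
  | .land, a, b => a &&& b
  | .lor, a, b => a ||| b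
  | .xor, a, b => a ^^^ b
  | .shl, a, b => a <<< b
  | .shr, a, b => a >>> b
  | .lt, a, b => if a < b then 1 else 0
  | .eq, a, b => if a = b then 1 else 0

/-- Programs. Registers are named by natural numbers; a program mentions finitely many of them. -/
inductive Prog
  /-- `const r v` puts the constant `v` into register `r`. -/
  | const (r v : ℕ)
  /-- `op o r a b` puts the result of `o` on registers `a` and `b` into register `r`. -/
  | op (o : Op) (r a b : ℕ)
  /-- `probe r a` puts the cell of the data structure addressed by register `a` into `r`. -/
  | probe (r a : ℕ)
  /-- `load r a` puts the scratch cell addressed by register `a` into register `r`. -/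
  | load (r a : ℕ)
  /-- `store a b` puts register `b` into the scratch cell addressed by register `a`. -/
  | store (a b : ℕ)
  /-- Sequential composition. -/
  | seq (p q : Prog)
  /-- `ite r p q` runs `p` if register `r` is nonzero, and `q` otherwise. -/
  | ite (r : ℕ) (p q : Prog)
  /-- `loop r p` runs `p` as long as register `r` is nonzero. -/
  | loop (r : ℕ) (p : Prog)

/-- The contents of the registers and of the scratch memory. -/
structure State where
  reg : ℕ → ℕ
  mem : ℕ → ℕ

/-- Write `v` into register `r`. -/
def State.setReg (s : State) (r v : ℕ) : State := ⟨Function.update s.reg r v, s.mem⟩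

/-- Write `v` into scratch cell `a`. -/
def State.setMem (s : State) (a v : ℕ) : State := ⟨s.reg, Function.update s.mem a v⟩

/-- The state in which a query `(i, j)` starts: `i` and `j` are in registers `0` and `1`, and
everything else is zero. -/
def State.init (i j : ℕ) : State :=
  ⟨fun r => if r = 0 then i else if r = 1 then j else 0, fun _ => 0⟩

/-- `Exec W D p s t s'`: with words smaller than `W` and stored data structure `D`, the program `p`
started in state `s` halts in state `s'` after exactly `t` steps. A program that produces a value
that is not a word, or that reads outside of `D`, has no execution. -/
inductive Exec (W : ℕ) (D : List ℕ) : Prog → State → ℕ → State → Prop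
  | const {r v : ℕ} {s : State} (hv : v < W) :
      Exec W D (.const r v) s 1 (s.setReg r v)
  | op {o : Op} {r a b : ℕ} {s : State} (hv : o.eval (s.reg a) (s.reg b) < W) :
      Exec W D (.op o r a b) s 1 (s.setReg r (o.eval (s.reg a) (s.reg b)))
  | probe {r a : ℕ} {s : State} (ha : s.reg a < D.length) :
      Exec W D (.probe r a) s 1 (s.setReg r D[s.reg a])
  | load {r a : ℕ} {s : State} :
      Exec W D (.load r a) s 1 (s.setReg r (s.mem (s.reg a)))
  | store {a b : ℕ} {s : State} :
      Exec W D (.store a b) s 1 (s.setMem (s.reg a) (s.reg b))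
  | seq {p q : Prog} {s₁ s₂ s₃ : State} {t₁ t₂ : ℕ}
      (hp : Exec W D p s₁ t₁ s₂) (hq : Exec W D q s₂ t₂ s₃) :
      Exec W D (.seq p q) s₁ (t₁ + t₂) s₃
  | iteTrue {r : ℕ} {p q : Prog} {s s' : State} {t : ℕ} (hr : s.reg r ≠ 0)
      (hp : Exec W D p s t s') : Exec W D (.ite r p q) s (t + 1) s'
  | iteFalse {r : ℕ} {p q : Prog} {s s' : State} {t : ℕ} (hr : s.reg r = 0)
      (hq : Exec W D q s t s') : Exec W D (.ite r p q) s (t + 1) s'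
  | loopDone {r : ℕ} {p : Prog} {s : State} (hr : s.reg r = 0) :
      Exec W D (.loop r p) s 1 s
  | loopStep {r : ℕ} {p : Prog} {s₁ s₂ s₃ : State} {t₁ t₂ : ℕ} (hr : s₁.reg r ≠ 0)
      (hp : Exec W D p s₁ t₁ s₂) (hl : Exec W D (.loop r p) s₂ t₂ s₃) :
      Exec W D (.loop r p) s₁ (t₁ + t₂ + 1) s₃

end WordRAM

/-! ## SetDisjointness -/

namespace SetDisjointness

/-- The total number `N` of elements in all sets `S₁, …, Sₘ`. -/
def total {m : ℕ} (S : Fin m → Finset ℕ) : ℕ := ∑ i, (S i).card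

/-- A data structure for SetDisjointness: a preprocessing map, which turns a family of sets into a
list of words and on whose resources there is no bound, and a query program. Words are the numbers
smaller than `(N + 2) ^ wordExp`. -/
structure DataStructure where
  build : {m : ℕ} → (Fin m → Finset ℕ) → List ℕ
  query : WordRAM.Prog
  wordExp : ℕ

/-- On the family `S`, the data structure occupies at most `space` words, and for each pair `(i, j)`
the query program decides within `time` steps whether `S i` and `S j` are disjoint: it halts with
`1` in register `0` if they are, and with `0` if they are not. -/
def DataStructure.Handles (A : DataStructure) {m : ℕ} (S : Fin m → Finset ℕ)
    (space time : ℕ) : Prop :=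
  (A.build S).length ≤ space ∧
  (∀ x ∈ A.build S, x < (total S + 2) ^ A.wordExp) ∧
  ∀ i j : Fin m, ∃ t ≤ time, ∃ s : WordRAM.State,
    WordRAM.Exec ((total S + 2) ^ A.wordExp) (A.build S) A.query (.init i j) t s ∧
    s.reg 0 = if Disjoint (S i) (S j) then 1 else 0

/-- `A` solves SetDisjointness with `space N` words and query time `time N`, where `N` is the total
size of the sets. Empty sets are allowed, but at most `N` sets in all, so that `N` measures the size
of the input. -/
def DataStructure.Solves (A : DataStructure) (space time : ℕ → ℕ) : Prop :=
  ∀ (N m : ℕ) (S : Fin m → Finset ℕ), m ≤ N → total S = N → A.Handles S (space N) (time N)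

/-- `m` lies in the range `[N / u ^ (1 / 2), N / u ^ (1 / 2 - ε)]` (and there are at most `N` sets,
which follows from the upper end of the range if `ε ≤ 1 / 2`). -/
def InRange (ε : ℝ) (u N m : ℕ) : Prop :=
  (N : ℝ) / (u : ℝ) ^ (1 / 2 : ℝ) ≤ m ∧ (m : ℝ) ≤ (N : ℝ) / (u : ℝ) ^ (1 / 2 - ε) ∧ m ≤ N

/-- `A` solves SetDisjointness with universe `[u N]` for all `m` in the above range, with
`space N m` words and query time `time N m`. -/
def DataStructure.SolvesBounded (A : DataStructure) (u : ℕ → ℕ) (ε : ℝ)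
    (space time : ℕ → ℕ → ℕ) : Prop :=
  ∀ (N m : ℕ) (S : Fin m → Finset ℕ), InRange ε (u N) N m →
    (∀ i, S i ⊆ Finset.Icc 1 (u N)) → total S = N → A.Handles S (space N m) (time N m)

/-- The Strong SetDisjointness Conjecture: any data structure for SetDisjointness that answers
queries in time `T` must use `Ω̃(N ^ 2 / T ^ 2)` space. -/
def StrongConjecture : Prop :=
  ∀ (A : DataStructure) (space time : ℕ → ℕ), A.Solves space time →
    ∃ (c : ℝ) (k : ℕ), 0 < c ∧ ∀ᶠ N : ℕ in atTop,
      c * ((N : ℝ) ^ 2 / (time N : ℝ) ^ 2) / Real.log N ^ k ≤ space N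

end SetDisjointness

/-! ### Execution rules with step budgets -/

namespace WordRAM

/-! Suppose that for some θ > 0 there are infinitely many N at which, for every m in the range, the
given structure has space below m^(2-θ) and query time below u^(1/2-θ). At these N it yields a
structure for arbitrary families that beats N²/T² by a power of u ≥ N^δ, which no power of log N
absorbs; this contradicts the conjecture.

Fix a small α. Sets with at most τ = ⌊u^(1/2-α)⌋ elements are scanned, each element being looked up
in the other set by binary search. At most N/u^(1/2-α) big sets remain. Their elements are hashed
into [u], the images are padded to m' = ⌊N/u^(1/2-2α)⌋ sets of total size exactly N, and the given
structure is applied. Hashing errs only on disjoint pairs whose images meet; these are stored in a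
dictionary that is consulted first. For two sets of at most H = ⌊u^(1/2-α/4)⌋ elements a random map
errs with probability at most H²/u ≤ u^(-α/2), and pairs with a larger set are few. Hence the space
is O(G) with G = N²/u^(1-3α/2), the time is T = O(u^(1/2-α) log N), and G T² = O(N² u^(-α/2) log²
N).

`exists_hash` is the averaging argument and `exists_padding` the padding; `exists_reduced_data`
assembles the reduction. `runs_combine` and `exists_combined_data` implement it with one query
program for all N. `parameter_bounds` and `exception_bound` bound the space,
`eventually_exists_large` derives the contradiction for fixed θ, and
`exists_tendsto_of_forall_eventually` lets θ tend to 0. -/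

@[simp] theorem State.setReg_reg (s : State) (r v x : ℕ) :
    (s.setReg r v).reg x = if x = r then v else s.reg x := by
  simp [State.setReg, Function.update_apply]

@[simp] theorem State.setReg_mem (s : State) (r v : ℕ) : (s.setReg r v).mem = s.mem := rfl

/-- From state `s` the program `p` halts within `t` steps in a state satisfying `Q`. -/
def Runs (W : ℕ) (D : List ℕ) (p : Prog) (s : State) (t : ℕ) (Q : State → Prop) : Prop :=
  ∃ t' ≤ t, ∃ s', Exec W D p s t' s' ∧ Q s'

section Rules

variable {W : ℕ} {D : List ℕ} {s : State} {t t₁ t₂ : ℕ} {Q Q' : State → Prop} {p q : Prog}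

theorem Runs.mono (h : Runs W D p s t₁ Q) (ht : t₁ ≤ t₂) (hQ : ∀ s', Q s' → Q' s') :
    Runs W D p s t₂ Q' := by
  obtain ⟨t', ht', s', he, hq⟩ := h
  exact ⟨t', ht'.trans ht, s', he, hQ _ hq⟩

theorem runs_const {r v : ℕ} (hv : v < W) (hQ : Q (s.setReg r v)) :
    Runs W D (.const r v) s 1 Q := ⟨1, le_rfl, _, .const hv, hQ⟩

theorem runs_op {o : Op} {r a b : ℕ} (hv : o.eval (s.reg a) (s.reg b) < W)
    (hQ : Q (s.setReg r (o.eval (s.reg a) (s.reg b)))) :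
    Runs W D (.op o r a b) s 1 Q := ⟨1, le_rfl, _, .op hv, hQ⟩

/-- Nesting the second run in the postcondition of the first lets programs be verified by forward
symbolic execution while the budgets add up. -/
theorem runs_seq (h : Runs W D p s t₁ fun s' => Runs W D q s' t₂ Q) :
    Runs W D (.seq p q) s (t₁ + t₂) Q := by
  obtain ⟨t', ht', s', he, t'', ht'', s'', he', hq⟩ := h
  exact ⟨t' + t'', by omega, s'', .seq he he', hq⟩

theorem runs_ite {r : ℕ} (h₁ : s.reg r ≠ 0 → Runs W D p s t Q)
    (h₂ : s.reg r = 0 → Runs W D q s t Q) : Runs W D (.ite r p q) s (t + 1) Q := by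
  by_cases hr : s.reg r = 0
  · obtain ⟨t', ht', s', he, hq⟩ := h₂ hr
    exact ⟨t' + 1, by omega, s', .iteFalse hr he, hq⟩
  · obtain ⟨t', ht', s', he, hq⟩ := h₁ hr
    exact ⟨t' + 1, by omega, s', .iteTrue hr he, hq⟩

theorem runs_loop_done {r : ℕ} (hr : s.reg r = 0) (hQ : Q s) : Runs W D (.loop r p) s 1 Q :=
  ⟨1, le_rfl, _, .loopDone hr, hQ⟩

theorem runs_loop_step {r : ℕ} (hr : s.reg r ≠ 0)
    (h : Runs W D p s t₁ fun s' => Runs W D (.loop r p) s' t₂ Q) :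
    Runs W D (.loop r p) s (t₁ + t₂ + 1) Q := by
  obtain ⟨t', ht', s', he, t'', ht'', s'', he', hq⟩ := h
  exact ⟨t' + t'' + 1, by omega, s'', .loopStep hr he he', hq⟩

end Rules

/-! ### Array access, relocation and binary search -/

/-- The list of `8 * M` cells in which eight arrays `ch 0, …, ch 7` of length `M` are
interleaved. -/
def layout (M : ℕ) (ch : ℕ → ℕ → ℕ) : List ℕ :=
  (List.range (8 * M)).map fun a => ch (a % 8) (a / 8)

@[simp] theorem length_layout (M : ℕ) (ch : ℕ → ℕ → ℕ) : (layout M ch).length = 8 * M := by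
  simp [layout]

/-- Read entry `reg a` of array `c` into register `r`. -/
def fetch (r c a : ℕ) : Prog :=
  .seq (.const 10 8) <| .seq (.op .mul 10 10 a) <| .seq (.const 11 c) <|
    .seq (.op .add 10 10 11) (.probe r 10)

/-- Entry v of array c sits in cell 8v + c. The bound `8 * M ≤ W` makes addresses words, and `2 ≤ M`
does so for the constant 8. Register 10 is overwritten before `a` is read, hence `a ≠ 10`. -/
theorem runs_fetch {W M : ℕ} {ch : ℕ → ℕ → ℕ} {s : State} {Q : State → Prop} {r c a : ℕ}
    (hW : 8 * M ≤ W) (hM : 2 ≤ M) (hc : c < 8) (ha : a ≠ 10 := by decide)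
    (haM : s.reg a < M)
    (hQ : Q (((s.setReg 10 (8 * s.reg a + c)).setReg 11 c).setReg r (ch c (s.reg a)))) :
    Runs W (layout M ch) (fetch r c a) s 5 Q := by
  set v := s.reg a with hv
  refine runs_seq (t₁ := 1) (t₂ := 4) (runs_const (by omega) ?_)
  refine runs_seq (t₁ := 1) (t₂ := 3) (runs_op ?_ ?_)
  · simp [Op.eval, ha]; omega
  refine runs_seq (t₁ := 1) (t₂ := 2) (runs_const (by omega) ?_)
  refine runs_seq (t₁ := 1) (t₂ := 1) (runs_op ?_ ?_)
  · simp [Op.eval, ha]; omega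
  have hlt : 8 * v + c < (layout M ch).length := by rw [length_layout]; omega
  have hcell : (layout M ch)[8 * v + c] = ch c v := by
    simp only [layout, List.getElem_map, List.getElem_range]
    congr 1 <;> omega
  have hst : ∀ s' : State, s' = (s.setReg 10 (8 * v + c)).setReg 11 c →
      Runs W (layout M ch) (.probe r 10) s' 1 Q := by
    rintro _ rfl
    refine ⟨1, le_rfl, _, .probe (by simpa using hlt), ?_⟩
    convert hQ using 2
    simpa using hcell
  -- Register 10 has been written three times; extensionality reduces the state to the two final
  -- writes.
  apply hst
  simp only [State.setReg, Op.eval]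
  congr 1
  funext x
  simp only [Function.update_apply]
  by_cases h10 : x = 10 <;> by_cases h11 : x = 11 <;> simp [h10, h11, ha, hv]

/-- The program `p` with its registers moved up by 20, reading its data from array `5`. -/
def relocate : Prog → Prog
  | .const r v => .const (r + 20) v
  | .op o r a b => .op o (r + 20) (a + 20) (b + 20)
  | .probe r a => fetch (r + 20) 5 (a + 20)
  | .load r a => .load (r + 20) (a + 20)
  | .store a b => .store (a + 20) (b + 20)
  | .seq p q => .seq (relocate p) (relocate q)
  | .ite r p q => .ite (r + 20) (relocate p) (relocate q)
  | .loop r p => .loop (r + 20) (relocate p)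

/-- The state `s'` carries the state `s` in its registers from 20 on and in its memory. -/
def Carries (s' s : State) : Prop := (∀ r, s'.reg (r + 20) = s.reg r) ∧ s'.mem = s.mem

theorem Carries.setReg {s' s : State} (h : Carries s' s) (r v : ℕ) :
    Carries (s'.setReg (r + 20) v) (s.setReg r v) :=
  ⟨fun x => by simp [h.1], by simp [h.2]⟩

/-- Induction on the execution, so that loops need no separate argument. Only a probe grows, to five
instructions, and its auxiliary registers 10 and 11 lie below the relocated ones. -/
theorem runs_relocate {W W' M : ℕ} {D : List ℕ} {ch : ℕ → ℕ → ℕ} (hWW : W ≤ W')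
    (hW : 8 * M ≤ W') (hM : 2 ≤ M) (hDM : D.length ≤ M)
    (hD : ∀ k (h : k < D.length), ch 5 k = D[k]) {p : Prog} {s₁ s₂ : State} {t : ℕ}
    (h : Exec W D p s₁ t s₂) :
    ∀ s, Carries s s₁ →
      Runs W' (layout M ch) (relocate p) s (5 * t) fun s' => Carries s' s₂ := by
  induction h with
  | @const r v s hv =>
    intro s' hs
    exact Runs.mono (t₁ := 1) (runs_const (hv.trans_le hWW) (hs.setReg _ _)) (by omega)
      fun _ h => h
  | @op o r a b s hv =>
    intro s' hs
    refine Runs.mono (t₁ := 1) (runs_op ?_ ?_) (by omega) fun _ h => h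
    · rw [hs.1, hs.1]; exact hv.trans_le hWW
    · rw [hs.1, hs.1]; exact hs.setReg _ _
  | @probe r a s ha =>
    intro s' hs
    refine runs_fetch hW hM (by decide) (by omega) ?_ ?_
    · rw [hs.1]; omega
    · rw [hs.1, hD _ ha]
      exact ⟨fun x => by simp [hs.1], by simp [hs.2]⟩
  | @load r a s =>
    intro s' hs
    refine ⟨1, by omega, _, .load, ?_⟩
    rw [hs.1, hs.2]; exact hs.setReg _ _
  | @store a b s =>
    intro s' hs
    refine ⟨1, by omega, _, .store, ?_⟩
    rw [hs.1, hs.1]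
    exact ⟨fun x => hs.1 x, by simp [State.setMem, hs.2]⟩
  | seq hp hq ihp ihq =>
    intro s' hs
    exact (runs_seq ((ihp s' hs).mono le_rfl fun _ h => ihq _ h)).mono (by omega) fun _ h => h
  | iteTrue hr hp ih =>
    intro s' hs
    exact (runs_ite (fun _ => ih s' hs) fun h => absurd (hs.1 _ ▸ h) hr).mono (by omega)
      fun _ h => h
  | iteFalse hr hp ih =>
    intro s' hs
    exact (runs_ite (fun h => absurd hr (hs.1 _ ▸ h)) fun _ => ih s' hs).mono (by omega)
      fun _ h => h
  | loopDone hr =>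
    intro s' hs
    exact Runs.mono (t₁ := 1) (runs_loop_done ((hs.1 _).trans hr) hs) (by omega) fun _ h => h
  | loopStep hr hp hl ihp ihl =>
    intro s' hs
    exact (runs_loop_step (by rw [hs.1]; exact hr)
      ((ihp s' hs).mono le_rfl fun _ h => ihl _ h)).mono (by omega) fun _ h => h

/-- One step of a binary search for register `5` in array `4`. -/
def searchStep : Prog :=
  .seq (.op .add 9 7 8) <| .seq (fetch 6 4 9) <| .seq (.op .lt 6 5 6) <|
    .seq (.ite 6 (.const 6 0) (.op .land 7 9 9)) <| .seq (.const 6 2) (.op .div 8 8 6)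

/-- Binary search for register `5` in array `4`; register `6` tells whether it was found. -/
def search : Prog :=
  .seq (.const 8 0) <| .seq (fetch 8 0 8) <| .seq (.const 7 0) <| .seq (.loop 8 searchStep) <|
    .seq (fetch 6 4 7) (.op .eq 6 6 5)

/-- The states agree except on the working registers `6, …, 11` of the search. -/
def SameButWork (s' s : State) : Prop :=
  s'.mem = s.mem ∧ ∀ x, x < 6 ∨ 11 < x → s'.reg x = s.reg x

/-- Loop invariant: if the key occurs at all, it occurs in the window of length `2 ^ k` starting at
register 7. Register 8 holds half that length; truncated division makes it zero, and stops the loop,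
exactly at length one. -/
theorem runs_search_loop {W M L : ℕ} {ch : ℕ → ℕ → ℕ} (hW : 8 * M ≤ W) (hM : 2 ≤ M)
    (hL : 2 ^ (L + 1) ≤ M) (hmono : Monotone (ch 4)) (s₀ : State) :
    ∀ (k : ℕ) (s : State), SameButWork s s₀ → s.reg 8 = 2 ^ k / 2 →
      s.reg 7 + 2 ^ k ≤ 2 ^ (L + 1) →
      ((∃ p < 2 ^ (L + 1), ch 4 p = s₀.reg 5) →
        ∃ p, s.reg 7 ≤ p ∧ p < s.reg 7 + 2 ^ k ∧ ch 4 p = s₀.reg 5) →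
      Runs W (layout M ch) (.loop 8 searchStep) s (12 * k + 1) fun s' =>
        SameButWork s' s₀ ∧ s'.reg 7 < 2 ^ (L + 1) ∧
        ((∃ p < 2 ^ (L + 1), ch 4 p = s₀.reg 5) → ch 4 (s'.reg 7) = s₀.reg 5) := by
  intro k
  induction k with
  | zero =>
    intro s hs h8 h7 hp
    refine runs_loop_done (by simpa using h8) ⟨hs, by simpa using h7, fun h => ?_⟩
    obtain ⟨p, h1, h2, h3⟩ := hp h
    have : p = s.reg 7 := by simp at h2; omega
    exact this ▸ h3
  | succ k ih =>
    intro s hs h8 h7 hp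
    have h8' : s.reg 8 = 2 ^ k := by rw [h8, pow_succ]; omega
    have hpos : 0 < 2 ^ k := by positivity
    have h5 : s.reg 5 = s₀.reg 5 := hs.2 5 (by decide)
    rw [pow_succ] at h7
    refine Runs.mono (t₁ := 11 + (12 * k + 1) + 1) (runs_loop_step (by omega) ?_) (by omega)
      fun _ h => h
    refine runs_seq (t₁ := 1) (t₂ := 10) (runs_op (by simp only [Op.eval]; omega) ?_)
    refine runs_seq (t₁ := 5) (t₂ := 5) (runs_fetch hW hM (by decide) (by decide)
      (by simp [Op.eval]; omega) ?_)
    refine runs_seq (t₁ := 1) (t₂ := 4) (runs_op (by simp [Op.eval]; split <;> omega) ?_)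
    refine runs_seq (t₁ := 2) (t₂ := 2) (runs_ite (t := 1) ?_ ?_)
    · intro hlt
      simp [Op.eval, h8', h5] at hlt
      refine runs_const (by omega) (runs_seq (t₁ := 1) (t₂ := 1) (runs_const (by omega)
        (runs_op (by simp [Op.eval]; omega) ?_)))
      refine ih _ ⟨by simp [hs.1], fun x hx => ?_⟩ (by simp [Op.eval, h8']) (by simp; omega) ?_
      · have := hs.2 x hx
        simp [show x ≠ 8 by omega, show x ≠ 6 by omega, show x ≠ 11 by omega,
          show x ≠ 10 by omega, show x ≠ 9 by omega, this]
      · intro h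
        obtain ⟨p, h1, h2, h3⟩ := hp h
        refine ⟨p, by simpa using h1, ?_, h3⟩
        by_contra hcon
        simp at hcon
        have := hmono hcon
        omega
    · intro hlt
      simp [Op.eval, h8', h5] at hlt
      refine runs_op (by simp [Op.eval]; omega) (runs_seq (t₁ := 1) (t₂ := 1)
        (runs_const (by omega) (runs_op (by simp [Op.eval]; omega) ?_)))
      refine ih _ ⟨by simp [hs.1], fun x hx => ?_⟩ (by simp [Op.eval, h8'])
        (by simp [Op.eval]; omega) ?_
      · have := hs.2 x hx
        simp [show x ≠ 8 by omega, show x ≠ 6 by omega, show x ≠ 11 by omega,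
          show x ≠ 10 by omega, show x ≠ 9 by omega, show x ≠ 7 by omega, this]
      · intro h
        obtain ⟨p, h1, h2, h3⟩ := hp h
        rw [pow_succ] at h2
        by_cases hc : s.reg 7 + 2 ^ k ≤ p
        · exact ⟨p, by simpa [Op.eval, h8'] using hc, by simp [Op.eval, h8']; omega, h3⟩
        -- An occurrence below the midpoint forces equality at the midpoint by monotonicity, since
        -- the midpoint entry does not exceed the key.
        · refine ⟨s.reg 7 + 2 ^ k, by simp [Op.eval, h8'], by simp [Op.eval, h8'], ?_⟩
          exact le_antisymm hlt (h3 ▸ hmono (by omega))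

theorem runs_search {W M L : ℕ} {ch : ℕ → ℕ → ℕ} (hW : 8 * M ≤ W) (hM : 2 ≤ M)
    (hL : 2 ^ (L + 1) ≤ M) (hmono : Monotone (ch 4)) (h0 : ch 0 0 = 2 ^ L) (s : State) :
    Runs W (layout M ch) search s (12 * L + 26) fun s' =>
      SameButWork s' s ∧ (s'.reg 6 ≠ 0 ↔ ∃ p < 2 ^ (L + 1), ch 4 p = s.reg 5) := by
  refine Runs.mono (t₁ := 1 + (5 + (1 + ((12 * (L + 1) + 1) + (5 + 1))))) ?_ (by omega)
    fun _ h => h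
  refine runs_seq (runs_const (by omega) ?_)
  refine runs_seq (runs_fetch hW hM (by decide) (by decide) (by simp; omega) ?_)
  refine runs_seq (runs_const (by omega) ?_)
  refine runs_seq ((runs_search_loop hW hM hL hmono s (L + 1) _ ⟨by simp, fun x hx => ?_⟩
    (by simp [h0, pow_succ]) (by simp) ?_).mono le_rfl ?_)
  · simp [show x ≠ 8 by omega, show x ≠ 11 by omega, show x ≠ 10 by omega, show x ≠ 7 by omega]
  · rintro ⟨p, h1, h2⟩
    exact ⟨p, by simp, by simpa using h1, h2⟩
  · rintro s' ⟨hs, h7, hp⟩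
    refine runs_seq (runs_fetch hW hM (by decide) (by decide) (by omega) ?_)
    refine runs_op (by simp [Op.eval]; split <;> omega) ⟨⟨by simp [hs.1], fun x hx => ?_⟩, ?_⟩
    · simp [show x ≠ 6 by omega, show x ≠ 11 by omega, show x ≠ 10 by omega, hs.2 x hx]
    · have h5 := hs.2 5 (by decide)
      simp [Op.eval, h5]
      exact ⟨fun h => ⟨_, h7, h⟩, fun ⟨p, h1, h2⟩ => hp ⟨p, h1, h2⟩⟩

end WordRAM

/-! ### The combined query program -/

namespace WordRAM

/-- Test the element in position `reg 4 + reg 3` of array `3` for membership in the set `reg 13`,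
after lowering register `3`. -/
def scanStep : Prog :=
  .seq (.const 5 1) <| .seq (.op .sub 3 3 5) <| .seq (.op .add 5 4 3) <| .seq (fetch 5 3 5) <|
    .seq (.op .mul 6 13 12) <| .seq (.op .add 5 6 5) <| .seq search <|
    .ite 6 (.const 14 0) (.const 6 0)

/-- Test `reg 3 - 1` elements from position `reg 4` of array `3` on for membership in the set
`reg 13`. -/
def scan : Prog :=
  .seq (.const 5 1) <| .seq (.op .sub 3 3 5) <| .seq (.const 14 1) <|
    .seq (.loop 3 scanStep) (.op .land 0 14 14)

/-- Look up the pair `(reg 0, reg 1)` in the dictionary, and if it is absent run `q` on the new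
names of the two sets. -/
def lookupOrRun (q : Prog) : Prog :=
  .seq (.op .mul 5 0 12) <| .seq (.op .add 5 5 1) <| .seq search <|
    .ite 6 (.const 0 1) <| .seq (fetch 20 2 0) <| .seq (fetch 21 2 1) <|
    .seq (relocate q) (.op .land 0 20 20)

/-- The query program: if one of the two sets is short, then scan it, otherwise use `q`. -/
def combine (q : Prog) : Prog :=
  .seq (.const 5 1) <| .seq (.const 12 0) <| .seq (fetch 12 0 5) <| .seq (fetch 3 1 0) <|
    .ite 3 (.seq (.op .land 13 1 1) <| .seq (fetch 4 2 0) scan) <|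
    .seq (fetch 3 1 1) <|
    .ite 3 (.seq (.op .land 13 0 0) <| .seq (fetch 4 2 1) scan) (lookupOrRun q)

section

variable {W M L : ℕ} {ch : ℕ → ℕ → ℕ}

open Classical in
-- Register 3 counts down, so the last element is tested first and the induction peels it off.
-- Register 14 is a flag that is cleared by any hit and never set again.
theorem runs_scan_loop (hW : 8 * M ≤ W) (hM : 2 ≤ M)
    (hL : 2 ^ (L + 1) ≤ M) (hmono : Monotone (ch 4)) (h0 : ch 0 0 = 2 ^ L) (b j Q : ℕ) :
    ∀ (n : ℕ) (s : State), s.reg 3 = n → s.reg 4 = b → s.reg 12 = Q → s.reg 13 = j →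
      (∀ t < n, b + t < M) → (∀ t < n, j * Q + ch 3 (b + t) < W) →
      Runs W (layout M ch) (.loop 3 scanStep) s (n * (12 * L + 40) + 1) fun s' =>
        s'.reg 14 =
          if ∀ t < n, ¬ ∃ p < 2 ^ (L + 1), ch 4 p = j * Q + ch 3 (b + t) then s.reg 14 else 0 := by
  intro n
  induction n with
  | zero =>
    intro s h3 _ _ _ _ _
    exact (runs_loop_done h3 (by simp)).mono (by omega) fun _ h => h
  | succ n ih =>
    intro s h3 h4 h12 h13 hb hw
    have hbn := hb n (by omega)
    have hwn := hw n (by omega)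
    refine Runs.mono (t₁ := (1 + (1 + (1 + (5 + (1 + (1 + ((12 * L + 26) + 2))))))) +
      (n * (12 * L + 40) + 1) + 1) (runs_loop_step (by omega) ?_) ?_ fun _ h => h
    · refine runs_seq (runs_const (by omega) ?_)
      refine runs_seq (runs_op (by simp [Op.eval]; omega) ?_)
      refine runs_seq (runs_op (by simp [Op.eval]; omega) ?_)
      refine runs_seq (runs_fetch hW hM (by decide) (by decide)
        (by simp [Op.eval, h3, h4]; omega) ?_)
      refine runs_seq (runs_op (by simp [Op.eval, h12, h13]; omega) ?_)
      refine runs_seq (runs_op (by simpa [Op.eval, h12, h13, h3, h4] using hwn) ?_)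
      refine runs_seq ((runs_search hW hM hL hmono h0 _).mono le_rfl ?_)
      rintro s' ⟨hs, h6⟩
      simp [Op.eval, h12, h13, h3, h4] at h6
      -- Handles both branches at once: v is the flag after the current test, w the flag at the end
      -- of the loop.
      have key : ∀ v w, (s'.reg 6 ≠ 0 → v = 0) → (s'.reg 6 = 0 → v = s.reg 14) →
          w = (if ∀ t < n, ¬ ∃ p < 2 ^ (L + 1), ch 4 p = j * Q + ch 3 (b + t) then v else 0) →
          w = (if ∀ t < n + 1, ¬ ∃ p < 2 ^ (L + 1), ch 4 p = j * Q + ch 3 (b + t)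
            then s.reg 14 else 0) := by
        intro v w hv0 hv1 hw
        rw [hw]
        by_cases h : s'.reg 6 = 0
        · rw [hv1 h]
          have hn : ¬ ∃ p < 2 ^ (L + 1), ch 4 p = j * Q + ch 3 (b + n) :=
            fun hp => (h6.2 hp) h
          congr 1
          refine propext ⟨fun hh t ht => ?_, fun hh t ht => hh t (by omega)⟩
          rcases Nat.lt_succ_iff_lt_or_eq.1 ht with h | rfl
          · exact hh t h
          · exact hn
        · rw [hv0 h, ite_self, if_neg]
          exact fun hh => hh n (by omega) (h6.1 h)
      have e3 : s'.reg 3 = n := by rw [hs.2 3 (by decide)]; simp [Op.eval, h3]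
      have e4 : s'.reg 4 = b := by rw [hs.2 4 (by decide)]; simp [Op.eval, h4]
      have e12 : s'.reg 12 = Q := by rw [hs.2 12 (by decide)]; simp [Op.eval, h12]
      have e13 : s'.reg 13 = j := by rw [hs.2 13 (by decide)]; simp [Op.eval, h13]
      have e14 : s'.reg 14 = s.reg 14 := by rw [hs.2 14 (by decide)]; simp [Op.eval]
      refine runs_ite (t := 1) (fun h => ?_) fun h => ?_
      · refine runs_const (by omega) ((ih _ ?_ ?_ ?_ ?_ ?_ ?_).mono le_rfl fun s'' h'' =>
          key 0 _ (fun _ => rfl) (fun h' => absurd h' h) (by simpa using h''))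
        all_goals try simp [e3, e4, e12, e13]
        · exact fun t ht => hb t (by omega)
        · exact fun t ht => hw t (by omega)
      · refine runs_const (by omega) ((ih _ ?_ ?_ ?_ ?_ ?_ ?_).mono le_rfl fun s'' h'' =>
          key (s.reg 14) _ (fun h' => absurd h h') (fun _ => rfl) (by simpa [e14] using h''))
        all_goals try simp [e3, e4, e12, e13]
        · exact fun t ht => hb t (by omega)
        · exact fun t ht => hw t (by omega)
    · rw [show (n + 1) * (12 * L + 40) = n * (12 * L + 40) + 12 * L + 40 by ring]
      generalize n * (12 * L + 40) = X
      omega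

open Classical in
theorem runs_scan (hW : 8 * M ≤ W) (hM : 2 ≤ M)
    (hL : 2 ^ (L + 1) ≤ M) (hmono : Monotone (ch 4)) (h0 : ch 0 0 = 2 ^ L) (b j Q n : ℕ)
    (s : State) (h3 : s.reg 3 = n + 1) (h4 : s.reg 4 = b) (h12 : s.reg 12 = Q)
    (h13 : s.reg 13 = j) (hn : n < W)
    (hb : ∀ t < n, b + t < M) (hw : ∀ t < n, j * Q + ch 3 (b + t) < W) :
    Runs W (layout M ch) scan s (n * (12 * L + 40) + 5) fun s' =>
      s'.reg 0 = if ∀ t < n, ¬ ∃ p < 2 ^ (L + 1), ch 4 p = j * Q + ch 3 (b + t) then 1 else 0 := by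
  refine Runs.mono (t₁ := 1 + (1 + (1 + ((n * (12 * L + 40) + 1) + 1)))) ?_ (by omega)
    fun _ h => h
  refine runs_seq (runs_const (by omega) ?_)
  refine runs_seq (runs_op (by simp [Op.eval]; omega) ?_)
  refine runs_seq (runs_const (by omega) ?_)
  refine runs_seq ((runs_scan_loop hW hM hL hmono h0 b j Q n _ (by simp [Op.eval, h3])
    (by simp [h4]) (by simp [h12]) (by simp [h13]) hb hw).mono le_rfl fun s' hs => ?_)
  rw [State.setReg_reg, if_pos rfl] at hs
  refine runs_op ?_ ?_
  · simp only [Op.eval, hs, Nat.and_self]; split <;> omega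
  · simp only [Op.eval, hs, Nat.and_self, State.setReg_reg, if_true]

/-- Correctness of `combine`: array `1` holds the lengths of the short sets plus one, and zero for
the other sets; array `2` holds the starting points of the short sets in array `3` and the new names
of the other sets; array `4` is a sorted dictionary and array `5` is the data of `q`. -/
theorem runs_combine (hW : 8 * M ≤ W) (hM : 2 ≤ M)
    (hL : 2 ^ (L + 1) ≤ M) (hmono : Monotone (ch 4)) (h0 : ch 0 0 = 2 ^ L) {Q : ℕ}
    (h1 : ch 0 1 = Q) {q : Prog} {W' : ℕ} {D' : List ℕ} (hW' : W' ≤ W) (hDM : D'.length ≤ M)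
    (hD : ∀ k (h : k < D'.length), ch 5 k = D'[k]) {i j T τ r : ℕ} (hi : i < M) (hj : j < M)
    (hr : r ≤ 1) (hτi : ch 1 i ≤ τ + 1) (hτj : ch 1 j ≤ τ + 1) (hτ : τ < M)
    (hshort : ∀ a b, (a = i ∧ b = j ∨ a = j ∧ b = i) → ch 1 a ≠ 0 →
      (∀ t < ch 1 a - 1, ch 2 a + t < M ∧ b * Q + ch 3 (ch 2 a + t) < W) ∧
      (r = 1 ↔ ∀ t < ch 1 a - 1, ¬ ∃ p < 2 ^ (L + 1), ch 4 p = b * Q + ch 3 (ch 2 a + t)))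
    (hkey : i * Q + j < W)
    (hlong : ch 1 i = 0 → ch 1 j = 0 →
      ((∃ p < 2 ^ (L + 1), ch 4 p = i * Q + j) → r = 1) ∧
      ((¬ ∃ p < 2 ^ (L + 1), ch 4 p = i * Q + j) →
        ∃ t ≤ T, ∃ s, Exec W' D' q (.init (ch 2 i) (ch 2 j)) t s ∧ s.reg 0 = r)) :
    Runs W (layout M ch) (combine q) (.init i j) ((τ + 2) * (12 * L + 60) + 5 * T)
      fun s' => s'.reg 0 = r := by
  have hone : ∀ P : Prop, ∀ [Decidable P], (r = 1 ↔ P) → (if P then 1 else 0) = r := by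
    intro P _ h
    by_cases hP : P
    · rw [if_pos hP, h.2 hP]
    · rw [if_neg hP]
      have := mt h.1 hP
      omega
  have hscan : ∀ a b, (a = i ∧ b = j ∨ a = j ∧ b = i) → ch 1 a ≠ 0 → ∀ s : State,
      s.reg 3 = ch 1 a → s.reg 4 = ch 2 a → s.reg 12 = Q → s.reg 13 = b →
      Runs W (layout M ch) scan s (τ * (12 * L + 40) + 5) fun s' => s'.reg 0 = r := by
    classical
    intro a b hab h s h3 h4 h12 h13
    obtain ⟨hs1, hs2⟩ := hshort a b hab h
    have hle : ch 1 a ≤ τ + 1 := by rcases hab with ⟨rfl, rfl⟩ | ⟨rfl, rfl⟩ <;> assumption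
    refine (runs_scan hW hM hL hmono h0 (ch 2 a) b Q (ch 1 a - 1) s (by omega) h4 h12 h13
      (by omega) (fun t ht => (hs1 t ht).1) fun t ht => (hs1 t ht).2).mono ?_ ?_
    · gcongr; omega
    · intro s' hs'
      rw [hs']
      exact hone _ hs2
  -- Each `max` is a branch: scan the first set, scan the second, or look up the pair and possibly
  -- run `q`.
  refine Runs.mono (t₁ := 1 + (1 + (5 + (5 + ((max (1 + (5 + (τ * (12 * L + 40) + 5)))
    (5 + (max (1 + (5 + (τ * (12 * L + 40) + 5)))
      (1 + (1 + ((12 * L + 26) + (max 1 (5 + (5 + (5 * T + 1))) + 1)))) + 1))) + 1))))) ?_ ?_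
    fun _ h => h
  · refine runs_seq (runs_const (by omega) ?_)
    refine runs_seq (runs_const (by omega) ?_)
    refine runs_seq (runs_fetch hW hM (by decide) (by decide) (by simp; omega) ?_)
    refine runs_seq (runs_fetch hW hM (by decide) (by decide) (by simpa [State.init] using hi) ?_)
    refine runs_ite (fun h => ?_) fun h => ?_
    · simp [State.init] at h
      refine Runs.mono ?_ (le_max_left _ _) fun _ h => h
      refine runs_seq (runs_op (by simp [State.init, Op.eval]; omega) ?_)
      refine runs_seq (runs_fetch hW hM (by decide) (by decide)
        (by simpa [State.init] using hi) ?_)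
      exact hscan i j (.inl ⟨rfl, rfl⟩) h _ (by simp [State.init]) (by simp [State.init])
        (by simp [h1]) (by simp [State.init, Op.eval])
    · simp [State.init] at h
      refine Runs.mono ?_ (le_max_right _ _) fun _ h => h
      refine runs_seq (runs_fetch hW hM (by decide) (by decide)
        (by simpa [State.init] using hj) ?_)
      refine runs_ite (fun h' => ?_) fun h' => ?_
      · simp [State.init] at h'
        refine Runs.mono ?_ (le_max_left _ _) fun _ h => h
        refine runs_seq (runs_op (by simp [State.init, Op.eval]; omega) ?_)
        refine runs_seq (runs_fetch hW hM (by decide) (by decide)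
          (by simpa [State.init] using hj) ?_)
        exact hscan j i (.inr ⟨rfl, rfl⟩) h' _ (by simp [State.init]) (by simp [State.init])
          (by simp [h1]) (by simp [State.init, Op.eval])
      · simp [State.init] at h'
        refine Runs.mono ?_ (le_max_right _ _) fun _ h => h
        obtain ⟨hl1, hl2⟩ := hlong h h'
        refine runs_seq (runs_op (by simp [State.init, Op.eval, h1]; omega) ?_)
        refine runs_seq (runs_op (by simpa [State.init, Op.eval, h1] using hkey) ?_)
        refine runs_seq ((runs_search hW hM hL hmono h0 _).mono le_rfl ?_)
        rintro s' ⟨⟨hsm, hs⟩, h6⟩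
        simp [State.init, Op.eval, h1] at h6
        refine runs_ite (fun h => ?_) fun h => ?_
        · exact Runs.mono (t₁ := 1) (runs_const (by omega) (by simp [hl1 (h6.1 h)]))
            (le_max_left _ _) fun _ h => h
        · refine Runs.mono ?_ (le_max_right _ _) fun _ h => h
          have e0 : s'.reg 0 = i := by rw [hs 0 (by decide)]; simp [State.init]
          have e1 : s'.reg 1 = j := by rw [hs 1 (by decide)]; simp [State.init]
          obtain ⟨t, ht, sf, hex, hres⟩ := hl2 fun hp => h6.2 hp h
          refine runs_seq (runs_fetch hW hM (by decide) (by decide) (by omega) ?_)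
          refine runs_seq (runs_fetch hW hM (by decide) (by decide) (by simp; omega) ?_)
          refine runs_seq ((runs_relocate hW' hW hM hDM hD hex _ ⟨fun x => ?_, ?_⟩).mono
            (by omega) ?_)
          -- The search leaves registers above 11 untouched, so those from 20 on are still zero, and
          -- the two fetches turn them into the initial state of `q`.
          · have := hs (x + 20) (by omega)
            simp [State.init] at this
            simp [State.init, e0, e1, this]
            by_cases hx0 : x = 0
            · simp [hx0]
            · by_cases hx1 : x = 1 <;> simp [hx0, hx1]
          · simp [hsm, State.init]
          · intro s'' hs''
            have e := hs''.1 0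
            simp only [Nat.zero_add] at e
            exact runs_op (by simp [Op.eval, e, hres]; omega) (by simp [Op.eval, e, hres])
  · have e : (τ + 2) * (12 * L + 60) = τ * (12 * L + 40) + 20 * τ + 24 * L + 120 := by ring
    rw [e]
    generalize τ * (12 * L + 40) = X
    omega

end

end WordRAM

/-! ### Contents of the arrays and the dictionary -/

namespace SetDisjointness

open WordRAM

/-- Beyond the sorted keys the array is filled with `B`, which preserves monotonicity and matches no
key below `B`. -/
theorem exists_monotone_array (K : Finset ℕ) {B : ℕ} (hB : ∀ k ∈ K, k < B) :
    ∃ a : ℕ → ℕ, Monotone a ∧ (∀ p, a p ≤ B) ∧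
      ∀ n, K.card ≤ n → ∀ k < B, (∃ p < n, a p = k) ↔ k ∈ K := by
  let e := K.orderEmbOfFin rfl
  have he : ∀ x, e x ∈ K := fun x => K.orderEmbOfFin_mem rfl x
  refine ⟨fun p => if h : p < K.card then e ⟨p, h⟩ else B, ?_, ?_, ?_⟩
  · intro p p' hp
    by_cases h' : p' < K.card
    · have h : p < K.card := by omega
      simp only [h, h', dif_pos]
      exact e.monotone (by simpa using hp)
    · by_cases h : p < K.card
      · simp only [h, h', dif_pos, dif_neg, not_false_eq_true]
        exact (hB _ (he _)).le
      · simp [h, h']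
  · intro p
    by_cases h : p < K.card
    · simp only [h, dif_pos]
      exact (hB _ (he _)).le
    · simp [h]
  · intro n hn k hk
    constructor
    · rintro ⟨p, -, hpk⟩
      by_cases h : p < K.card
      · simp only [h, dif_pos] at hpk
        exact hpk ▸ he _
      · simp only [h, dif_neg, not_false_eq_true] at hpk
        omega
    · intro hkK
      have : k ∈ Set.range e := by rw [Finset.range_orderEmbOfFin]; exact hkK
      obtain ⟨x, hx⟩ := this
      exact ⟨x, by omega, by simp [hx]⟩

theorem exists_flat_array {m : ℕ} (S : Fin m → Finset ℕ) :
    ∃ (start : Fin m → ℕ) (arr : ℕ → ℕ), (∀ i, start i + (S i).card ≤ total S) ∧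
      (∀ k, arr k = 0 ∨ ∃ i, arr k ∈ S i) ∧
      ∀ i x, x ∈ S i ↔ ∃ t < (S i).card, arr (start i + t) = x := by
  let n : Fin m → ℕ := fun i => (S i).card
  let e := finSigmaFinEquiv (n := n)
  let start : Fin m → ℕ := fun i => ∑ k : Fin i, n (Fin.castLE i.2.le k)
  have he : ∀ i (t : Fin (n i)), (e ⟨i, t⟩ : ℕ) = start i + t := fun i t => by
    simp [e, start, finSigmaFinEquiv_apply]
  let arr : ℕ → ℕ := fun k => if h : k < ∑ i, n i then
    (S (e.symm ⟨k, h⟩).1).orderEmbOfFin rfl (e.symm ⟨k, h⟩).2 else 0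
  have harr : ∀ i (t : Fin (n i)), arr (start i + t) = (S i).orderEmbOfFin rfl t := by
    intro i t
    have hlt : start i + t < ∑ i, n i := he i t ▸ (e ⟨i, t⟩).2
    have hsymm : e.symm ⟨start i + t, hlt⟩ = ⟨i, t⟩ := by
      rw [Equiv.symm_apply_eq]
      exact Fin.ext (he i t).symm
    simp only [arr, hlt, dif_pos]
    rw [hsymm]
  refine ⟨start, arr, fun i => ?_, fun k => ?_, fun i x => ⟨fun hx => ?_, ?_⟩⟩
  · have h1 : start i = ∑ k ∈ Finset.univ.filter (fun k : Fin m => k < i), n k := by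
      refine Finset.sum_bij (fun (k : Fin i) _ => Fin.castLE i.2.le k) ?_ ?_ ?_ ?_
      · intro k _
        simp only [Finset.mem_filter, Finset.mem_univ, true_and]
        exact k.2
      · intro k _ k' _ h
        simpa [Fin.ext_iff] using h
      · intro k hk
        simp only [Finset.mem_filter, Finset.mem_univ, true_and] at hk
        exact ⟨⟨k, hk⟩, Finset.mem_univ _, rfl⟩
      · intro k _
        rfl
    have h2 : i ∉ Finset.univ.filter (fun k : Fin m => k < i) := by simp
    calc start i + (S i).card
        = ∑ k ∈ insert i (Finset.univ.filter (fun k : Fin m => k < i)), n k := by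
          rw [Finset.sum_insert h2, h1, add_comm]
      _ ≤ total S := Finset.sum_le_sum_of_subset (Finset.subset_univ _)
  · by_cases h : k < ∑ i, n i
    · right
      refine ⟨(e.symm ⟨k, h⟩).1, ?_⟩
      simp only [arr, h, dif_pos]
      exact Finset.orderEmbOfFin_mem _ _ _
    · left
      simp [arr, h]
  · have : x ∈ Set.range ((S i).orderEmbOfFin rfl) := by
      rw [Finset.range_orderEmbOfFin]; exact hx
    obtain ⟨t, ht⟩ := this
    exact ⟨t, t.2, by rw [harr, ht]⟩
  · rintro ⟨t, ht, rfl⟩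
    rw [harr i ⟨t, ht⟩]
    exact Finset.orderEmbOfFin_mem _ _ _

/-- Elements are arbitrary naturals and need not be words, so they are replaced by their index in
the union. The shift by `total S` keeps the smaller numbers free for the dictionary keys of pairs of
sets. -/
theorem exists_renaming {m : ℕ} (S : Fin m → Finset ℕ) :
    ∃ f : ℕ → ℕ, (∀ i, ∀ x ∈ S i, ∀ j, ∀ y ∈ S j, f x = f y → x = y) ∧
      ∀ i, ∀ x ∈ S i, total S ≤ f x ∧ f x < 2 * total S := by
  let U := Finset.univ.biUnion S
  have hU : U.card ≤ total S := Finset.card_biUnion_le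
  have hmem : ∀ i, ∀ x ∈ S i, x ∈ U := fun i x hx =>
    Finset.mem_biUnion.2 ⟨i, Finset.mem_univ _, hx⟩
  refine ⟨fun x => if h : x ∈ U then total S + U.equivFin ⟨x, h⟩ else 0, ?_, ?_⟩
  · intro i x hx j y hy hxy
    simpa [hmem i x hx, hmem j y hy, Fin.ext_iff.symm] using hxy
  · intro i x hx
    have := (U.equivFin ⟨x, hmem i x hx⟩).2
    simp only [hmem i x hx, dif_pos]
    omega

/-- A data structure that answers queries about sets of at most `τ` elements by scanning them, and
otherwise answers with the dictionary `E` of pairs or, if the pair is not in `E`, with the program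
`q` and its data `D'`. -/
theorem exists_combined_data (q : Prog) {N m : ℕ} (S : Fin m → Finset ℕ) (hm : m ≤ N)
    (hN : total S = N) {w : ℕ} (hw : 8 ≤ w) (big : Finset (Fin m)) {τ : ℕ} (hτN : τ ≤ N)
    (hτ : ∀ i ∉ big, (S i).card ≤ τ) (E : Finset (Fin m × Fin m)) {D' : List ℕ} {W' : ℕ}
    (hW' : W' ≤ (N + 2) ^ w) (hlen : D'.length ≤ N ^ 2) (hD' : ∀ x ∈ D', x < (N + 2) ^ w)
    (rank : Fin m → ℕ) (hrank : ∀ i, rank i < (N + 2) ^ w) {T : ℕ}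
    (hE : ∀ i ∈ big, ∀ j ∈ big, ((i, j) ∈ E → Disjoint (S i) (S j)) ∧
      ((i, j) ∉ E → ∃ t ≤ T, ∃ s, Exec W' D' q (.init (rank i) (rank j)) t s ∧
        s.reg 0 = if Disjoint (S i) (S j) then 1 else 0)) :
    ∃ D : List ℕ, D.length ≤ 8 * (3 * N + 2 * E.card + D'.length + 4) ∧
      (∀ x ∈ D, x < (N + 2) ^ w) ∧
      ∀ i j : Fin m, ∃ t ≤ (τ + 2) * (12 * Nat.log 2 (N + N ^ 2) + 60) + 5 * T, ∃ s,
        Exec ((N + 2) ^ w) D (combine q) (.init i j) t s ∧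
        s.reg 0 = if Disjoint (S i) (S j) then 1 else 0 := by
  classical
  subst hN
  set N := total S with hN
  obtain ⟨f, hf, hfN⟩ := exists_renaming S
  let S' : Fin m → Finset ℕ := fun i => (S i).image f
  have hcard : ∀ i, (S' i).card = (S i).card := fun i =>
    Finset.card_image_of_injOn fun x hx y hy => hf i x hx i y hy
  have htot : total S' = N := by simp only [total, hcard]; rw [hN, total]
  have hS'N : ∀ i, ∀ x ∈ S' i, N ≤ x ∧ x < 2 * N := by
    intro i x hx
    obtain ⟨y, hy, rfl⟩ := Finset.mem_image.1 hx
    exact hfN i y hy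
  have hdisj : ∀ i j, Disjoint (S i) (S j) ↔ ∀ x ∈ S' i, x ∉ S' j := by
    intro i j
    rw [Finset.disjoint_left]
    constructor
    · intro h x hx hx'
      obtain ⟨y, hy, rfl⟩ := Finset.mem_image.1 hx
      obtain ⟨z, hz, hzy⟩ := Finset.mem_image.1 hx'
      exact h hy (hf j z hz i y hy hzy ▸ hz)
    · intro h x hx hx'
      exact h (f x) (Finset.mem_image_of_mem f hx) (Finset.mem_image_of_mem f hx')
  obtain ⟨start, arr, hstart, harr, hmem⟩ := exists_flat_array S'
  rw [htot] at hstart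
  let Q := 2 * N
  -- One dictionary holds memberships and exceptional pairs, as two-digit numbers in base `Q`. The
  -- last digit tells them apart: at least N for an element, below N for a set index.
  let K : Finset ℕ := (Finset.univ.biUnion fun i : Fin m => (S' i).image fun x => (i : ℕ) * Q + x) ∪
    E.image fun p => (p.1 : ℕ) * Q + (p.2 : ℕ)
  have hlt : ∀ (i : Fin m) (x : ℕ), x < Q → (i : ℕ) * Q + x < N * Q := by
    intro i x hx
    have : (i : ℕ) + 1 ≤ N := by omega
    calc (i : ℕ) * Q + x < ((i : ℕ) + 1) * Q := by rw [Nat.add_mul]; omega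
      _ ≤ N * Q := Nat.mul_le_mul_right _ this
  have hpair : ∀ j : Fin m, (j : ℕ) < N ∧ (j : ℕ) < Q := fun j => by
    have := j.2
    exact ⟨by omega, by simp only [Q]; omega⟩
  have hinj : ∀ {a b x y : ℕ}, x < Q → y < Q → a * Q + x = b * Q + y → a = b ∧ x = y := by
    intro a b x y hx hy h
    have h1 := congrArg (· / Q) h
    have h2 := congrArg (· % Q) h
    rw [mul_comm a, mul_comm b, Nat.mul_add_div (by omega), Nat.mul_add_div (by omega),
      Nat.div_eq_of_lt hx, Nat.div_eq_of_lt hy] at h1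
    rw [mul_comm a, mul_comm b, Nat.mul_add_mod, Nat.mul_add_mod, Nat.mod_eq_of_lt hx,
      Nat.mod_eq_of_lt hy] at h2
    exact ⟨by omega, h2⟩
  have hKB : ∀ k ∈ K, k < N * Q := by
    intro k hk
    simp only [K, Finset.mem_union, Finset.mem_biUnion, Finset.mem_univ, true_and,
      Finset.mem_image] at hk
    rcases hk with ⟨i, x, hx, rfl⟩ | ⟨p, -, rfl⟩
    · exact hlt i x (hS'N i x hx).2
    · exact hlt p.1 p.2 (hpair p.2).2
  have hKcard : K.card ≤ N + E.card := by
    refine (Finset.card_union_le _ _).trans (add_le_add ?_ Finset.card_image_le)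
    refine Finset.card_biUnion_le.trans ?_
    rw [← htot]
    exact Finset.sum_le_sum fun i _ => Finset.card_image_le
  have hKelem : ∀ (j : Fin m) (x : ℕ), N ≤ x → x < Q →
      ((j : ℕ) * Q + x ∈ K ↔ x ∈ S' j) := by
    intro j x hx hxQ
    simp only [K, Finset.mem_union, Finset.mem_biUnion, Finset.mem_univ, true_and,
      Finset.mem_image]
    constructor
    · rintro (⟨i, y, hy, h⟩ | ⟨p, -, h⟩)
      · obtain ⟨h1, rfl⟩ := hinj (hS'N i y hy).2 hxQ h
        exact Fin.ext h1 ▸ hy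
      · obtain ⟨h1, h2⟩ := hinj (hpair p.2).2 hxQ h
        have := (hpair p.2).1
        omega
    · exact fun h => .inl ⟨j, x, h, rfl⟩
  have hKpair : ∀ i j : Fin m, (i : ℕ) * Q + (j : ℕ) ∈ K ↔ (i, j) ∈ E := by
    intro i j
    simp only [K, Finset.mem_union, Finset.mem_biUnion, Finset.mem_univ, true_and,
      Finset.mem_image]
    constructor
    · rintro (⟨i', y, hy, h⟩ | ⟨p, hp, h⟩)
      · obtain ⟨h1, rfl⟩ := hinj (hS'N i' y hy).2 (hpair j).2 h
        have := (hpair j).1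
        have := (hS'N i' _ hy).1
        omega
      · obtain ⟨h1, h2⟩ := hinj (hpair p.2).2 (hpair j).2 h
        rwa [← Fin.ext h1, ← Fin.ext h2]
    · exact fun h => .inr ⟨(i, j), h, rfl⟩
  obtain ⟨a, hmono, haB, ha⟩ := exists_monotone_array K hKB
  have hEcard : E.card ≤ N ^ 2 := by
    calc E.card ≤ Fintype.card (Fin m × Fin m) := Finset.card_le_univ _
      _ = m ^ 2 := by simp [sq]
      _ ≤ N ^ 2 := Nat.pow_le_pow_left hm 2
  let L := Nat.log 2 (N + E.card)
  have hL1 : N + E.card < 2 ^ (L + 1) := Nat.lt_pow_succ_log_self (by norm_num) _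
  have hL2 : 2 ^ (L + 1) ≤ 2 * (N + E.card) + 2 := by
    rcases Nat.eq_zero_or_pos (N + E.card) with h | h
    · simp [L, h]
    · have := Nat.pow_log_le_self 2 h.ne'
      rw [pow_succ]
      simp only [L]
      omega
  have hLN : L ≤ Nat.log 2 (N + N ^ 2) := Nat.log_mono_right (by omega)
  let M := N + 2 ^ (L + 1) + D'.length + 2
  -- All addresses and keys are O(N²); `32 = 2 ^ 5` is absorbed by five further factors `N + 2`.
  have hbase : 32 * (N + 2) ^ 2 ≤ (N + 2) ^ w := by
    calc 32 * (N + 2) ^ 2 = 2 ^ 5 * (N + 2) ^ 2 := by norm_num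
      _ ≤ (N + 2) ^ 5 * (N + 2) ^ 2 := by gcongr; omega
      _ = (N + 2) ^ 7 := by ring
      _ ≤ (N + 2) ^ w := Nat.pow_le_pow_right (by omega) (by omega)
  have hMW : 8 * M ≤ (N + 2) ^ w := by
    refine le_trans ?_ hbase
    have : (N + 2) ^ 2 = N ^ 2 + 4 * N + 4 := by ring
    simp only [M]
    omega
  have hBW : N * Q < (N + 2) ^ w := by
    refine lt_of_lt_of_le ?_ hbase
    simp only [Q]
    nlinarith
  have hQW : Q < (N + 2) ^ w := by
    refine lt_of_lt_of_le ?_ hbase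
    simp only [Q]
    nlinarith
  let ch : ℕ → ℕ → ℕ := fun c k =>
    match c with
    | 0 => if k = 0 then 2 ^ L else if k = 1 then Q else 0
    | 1 => if h : k < m then if ⟨k, h⟩ ∈ big then 0 else (S ⟨k, h⟩).card + 1 else 0
    | 2 => if h : k < m then if ⟨k, h⟩ ∈ big then rank ⟨k, h⟩ else start ⟨k, h⟩ else 0
    | 3 => arr k
    | 4 => a k
    | 5 => D'.getD k 0
    | _ => 0
  have hch1 : ∀ i : Fin m, ch 1 i = if i ∈ big then 0 else (S i).card + 1 := fun i => by
    simp [ch, i.2]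
  have hch2 : ∀ i : Fin m, ch 2 i = if i ∈ big then rank i else start i := fun i => by
    simp [ch, i.2]
  have hMN : N + 2 ≤ M := by simp only [M]; omega
  have hbigW : N + 1 < (N + 2) ^ w := by omega
  have h0W : 0 < (N + 2) ^ w := by omega
  have harrW : ∀ k, arr k < (N + 2) ^ w := by
    intro k
    rcases harr k with h | ⟨i, hi⟩
    · omega
    · have := (hS'N i _ hi).2
      simp only [Q] at hQW
      omega
  have hSN : ∀ i, (S i).card ≤ N := fun i =>
    Finset.single_le_sum (f := fun i => (S i).card) (fun _ _ => Nat.zero_le _) (Finset.mem_univ i)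
  refine ⟨layout M ch, ?_, ?_, ?_⟩
  · rw [length_layout]
    simp only [M]
    omega
  · intro x hx
    simp only [layout, List.mem_map, List.mem_range] at hx
    obtain ⟨k, hk, rfl⟩ := hx
    generalize k / 8 = k'
    have hc : k % 8 < 8 := Nat.mod_lt _ (by norm_num)
    generalize k % 8 = c at hc
    have hLW : 2 ^ L < (N + 2) ^ w := by
      have h1 : 2 ^ L ≤ 2 ^ (L + 1) := Nat.pow_le_pow_right (by norm_num) (by omega)
      have h2 : 2 ^ (L + 1) < M := by simp only [M]; omega
      omega
    interval_cases c
    · simp only [ch]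
      split_ifs <;> omega
    · simp only [ch]
      split_ifs with h1 h2
      · exact h0W
      · have := hSN ⟨k', h1⟩
        omega
      · exact h0W
    · simp only [ch]
      split_ifs with h1 h2
      · exact hrank _
      · have := hstart ⟨k', h1⟩
        omega
      · exact h0W
    · exact harrW k'
    · exact (haB k').trans_lt hBW
    · simp only [ch]
      by_cases h : k' < D'.length
      · rw [List.getD_eq_getElem _ _ h]
        exact hD' _ (List.getElem_mem h)
      · rw [List.getD_eq_default _ _ (by omega)]
        exact h0W
    · exact h0W
    · exact h0W
  · intro i j
    have hite : ∀ P : Prop, ∀ [Decidable P], (if P then 1 else 0) = 1 ↔ P := by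
      intro P _
      split_ifs with h <;> simp [h]
    have hn : K.card ≤ 2 ^ (L + 1) := by omega
    have hle : ∀ i : Fin m, ch 1 i ≤ τ + 1 := by
      intro i
      rw [hch1]
      split_ifs with h
      · omega
      · have := hτ i h
        omega
    have hb : ∀ i : Fin m, ch 1 i = 0 → i ∈ big := by
      intro i h
      rw [hch1] at h
      by_contra hc
      simp [hc] at h
    have := runs_combine (W := (N + 2) ^ w) (M := M) (L := L) (ch := ch) hMW (by omega)
      (by simp only [M]; omega) hmono (by simp [ch]) (Q := Q) (by simp [ch]) (q := q) (D' := D')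
      (T := T) hW' (by simp only [M]; omega)
      (fun k h => by simp only [ch]; exact List.getD_eq_getElem _ _ h) (i := i) (j := j) (τ := τ)
      (r := if Disjoint (S i) (S j) then 1 else 0) (by omega) (by omega) (by split_ifs <;> omega)
      (hle i) (hle j) (by omega) ?_ ((hlt i j (hpair j).2).trans hBW) ?_
    · obtain ⟨t, ht, s, hex, hs⟩ := this
      refine ⟨t, ht.trans ?_, s, hex, hs⟩
      gcongr
    -- Either set of the pair may be the scanned one, so the claim is proved for an ordered pair and
    -- used in both orders.
    · have aux : ∀ x y : Fin m, ch 1 x ≠ 0 →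
          (∀ t < ch 1 x - 1, ch 2 x + t < M ∧ y * Q + ch 3 (ch 2 x + t) < (N + 2) ^ w) ∧
          (Disjoint (S x) (S y) ↔
            ∀ t < ch 1 x - 1, ¬ ∃ p < 2 ^ (L + 1), ch 4 p = y * Q + ch 3 (ch 2 x + t)) := by
        intro x y hx
        have hxb : x ∉ big := fun h => hx (by rw [hch1, if_pos h])
        have e1 : ch 1 x - 1 = (S' x).card := by rw [hch1, if_neg hxb, hcard]; rfl
        have e2 : ch 2 x = start x := by rw [hch2, if_neg hxb]
        rw [e1, e2]
        have hst := hstart x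
        have hin : ∀ t < (S' x).card, arr (start x + t) ∈ S' x := fun t ht =>
          (hmem x _).2 ⟨t, ht, rfl⟩
        have hQ : ∀ t < (S' x).card, (y : ℕ) * Q + arr (start x + t) < N * Q := fun t ht =>
          hlt y _ (hS'N x _ (hin t ht)).2
        refine ⟨fun t ht => ⟨by omega, (hQ t ht).trans hBW⟩, ?_⟩
        rw [hdisj]
        constructor
        · intro h t ht hp
          have hx' := hS'N x _ (hin t ht)
          exact h _ (hin t ht)
            ((hKelem y _ hx'.1 hx'.2).1 ((ha _ hn _ (hQ t ht)).1 hp))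
        · intro h z hz hz'
          obtain ⟨t, ht, rfl⟩ := (hmem x z).1 hz
          have hx' := hS'N x _ hz
          exact h t ht ((ha _ hn _ (hQ t ht)).2 ((hKelem y _ hx'.1 hx'.2).2 hz'))
      rintro _ _ (⟨rfl, rfl⟩ | ⟨rfl, rfl⟩) hx
      · exact ⟨(aux i j hx).1, (hite _).trans (aux i j hx).2⟩
      · exact ⟨(aux j i hx).1, (hite _).trans (disjoint_comm.trans (aux j i hx).2)⟩
    · intro h1 h2
      have hi := hb i h1
      have hj := hb j h2
      obtain ⟨hE1, hE2⟩ := hE i hi j hj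
      have hiff : (∃ p < 2 ^ (L + 1), ch 4 p = (i : ℕ) * Q + j) ↔ (i, j) ∈ E :=
        (ha _ hn _ (hlt i j (hpair j).2)).trans (hKpair i j)
      refine ⟨fun h => if_pos (hE1 (hiff.1 h)), fun h => ?_⟩
      rw [hch2, hch2, if_pos hi, if_pos hj]
      exact hE2 fun h' => h (hiff.2 h')

end SetDisjointness

/-! ### Hashing, padding and the reduction -/

namespace SetDisjointness

open WordRAM

/-- A uniform map collides at x and y with probability at most 1/u: overwriting the value at x of a
colliding map is injective in the map and the new value, because the old value survives at y. -/
theorem card_collision_mul_le {n u : ℕ} {x y : Fin n} (hxy : x ≠ y) :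
    (Finset.univ.filter fun h : Fin n → Fin u => h x = h y).card * u ≤
      Fintype.card (Fin n → Fin u) := by
  have : ((Finset.univ.filter fun h : Fin n → Fin u => h x = h y) ×ˢ
      (Finset.univ : Finset (Fin u))).card ≤ (Finset.univ : Finset (Fin n → Fin u)).card := by
    refine Finset.card_le_card_of_injOn (fun p => Function.update p.1 x p.2)
      (fun _ _ => Finset.mem_coe.2 (Finset.mem_univ _)) ?_
    rintro ⟨h, c⟩ hh ⟨h', c'⟩ hh' heq
    simp only [Finset.coe_product, Set.mem_prod, Finset.mem_coe, Finset.mem_filter,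
      Finset.mem_univ, true_and, and_true] at hh hh'
    dsimp only at heq
    have hz : ∀ z, z ≠ x → h z = h' z := fun z hz => by
      have := congrFun heq z
      simpa [Function.update_apply, hz] using this
    have hc : c = c' := by simpa using congrFun heq x
    refine Prod.ext (funext fun z => ?_) hc
    by_cases h1 : z = x
    · change h z = h' z
      rw [h1, hh, hh', hz y (Ne.symm hxy)]
    · exact hz z h1
  simpa [Finset.card_product] using this

/-- Some map into `[u]` makes few of the given pairs of disjoint sets intersect. -/
theorem exists_hash {m u : ℕ} (S : Fin m → Finset ℕ) (hu : 1 ≤ u) (P : Finset (Fin m × Fin m))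
    {B : ℕ} (hd : ∀ p ∈ P, Disjoint (S p.1) (S p.2))
    (hB : ∀ p ∈ P, (S p.1).card * (S p.2).card ≤ B) :
    ∃ h : ℕ → ℕ, (∀ x, h x ∈ Finset.Icc 1 u) ∧
      (P.filter fun p => ¬ Disjoint ((S p.1).image h) ((S p.2).image h)).card * u ≤
        P.card * B := by
  classical
  -- Only finitely many elements occur, so probabilities become counts over the finite type of maps
  -- `Fin n → Fin u`.
  obtain ⟨n, hn⟩ : ∃ n, ∀ i, ∀ x ∈ S i, x < n := by
    refine ⟨(Finset.univ.biUnion S).sup id + 1, fun i x hx => Nat.lt_succ_of_le ?_⟩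
    exact Finset.le_sup (f := id) (Finset.mem_biUnion.2 ⟨i, Finset.mem_univ _, hx⟩)
  let ext : (Fin n → Fin u) → ℕ → ℕ := fun h x => if hx : x < n then (h ⟨x, hx⟩ : ℕ) + 1 else 1
  let bad : (Fin n → Fin u) → Fin m × Fin m → Prop := fun h p =>
    ¬ Disjoint ((S p.1).image (ext h)) ((S p.2).image (ext h))
  -- Union bound over the pairs of elements, which are distinct because the two sets are disjoint.
  have hbad : ∀ p ∈ P, (Finset.univ.filter fun h => bad h p).card * u ≤
      B * Fintype.card (Fin n → Fin u) := by
    intro p hp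
    have hsub : (Finset.univ.filter fun h => bad h p) ⊆
        (S p.1 ×ˢ S p.2).biUnion fun z => Finset.univ.filter fun h => ext h z.1 = ext h z.2 := by
      intro h hh
      simp only [bad, Finset.mem_filter, Finset.mem_univ, true_and, Finset.not_disjoint_iff,
        Finset.mem_image] at hh
      obtain ⟨_, ⟨x, hx, rfl⟩, y, hy, hxy⟩ := hh
      simp only [Finset.mem_biUnion, Finset.mem_product, Finset.mem_filter, Finset.mem_univ,
        true_and]
      exact ⟨(x, y), ⟨hx, hy⟩, hxy.symm⟩
    calc (Finset.univ.filter fun h => bad h p).card * u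
        ≤ (∑ z ∈ S p.1 ×ˢ S p.2,
          (Finset.univ.filter fun h => ext h z.1 = ext h z.2).card) * u :=
          Nat.mul_le_mul_right _ ((Finset.card_le_card hsub).trans Finset.card_biUnion_le)
      _ = ∑ z ∈ S p.1 ×ˢ S p.2,
          (Finset.univ.filter fun h => ext h z.1 = ext h z.2).card * u := Finset.sum_mul _ _ _
      _ ≤ ∑ z ∈ S p.1 ×ˢ S p.2, Fintype.card (Fin n → Fin u) := by
          refine Finset.sum_le_sum fun z hz => ?_
          obtain ⟨h1, h2⟩ := Finset.mem_product.1 hz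
          have hne : z.1 ≠ z.2 := fun h =>
            Finset.disjoint_left.1 (hd p hp) h1 (h ▸ h2)
          have l1 := hn _ _ h1
          have l2 := hn _ _ h2
          refine le_trans (Nat.mul_le_mul_right _ (Finset.card_le_card ?_))
            (card_collision_mul_le (x := ⟨z.1, l1⟩) (y := ⟨z.2, l2⟩) (by simpa using hne))
          intro h hh
          simpa [ext, l1, l2, Fin.ext_iff] using hh
      _ = (S p.1).card * (S p.2).card * Fintype.card (Fin n → Fin u) := by
          rw [Finset.sum_const, Finset.card_product, smul_eq_mul]
      _ ≤ B * Fintype.card (Fin n → Fin u) := Nat.mul_le_mul_right _ (hB p hp)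
  have hne : (Finset.univ : Finset (Fin n → Fin u)).Nonempty := ⟨fun _ => ⟨0, hu⟩, Finset.mem_univ _⟩
  -- First moment: exchanging the sums bounds the average number of spoiled pairs, and some map does
  -- no worse than average.
  obtain ⟨h, -, hh⟩ := Finset.exists_le_of_sum_le
    (f := fun h => (P.filter fun p => bad h p).card * u) (g := fun _ => P.card * B) hne (by
      calc ∑ h, (P.filter fun p => bad h p).card * u
          = ∑ p ∈ P, (Finset.univ.filter fun h => bad h p).card * u := by
            simp only [Finset.card_filter, Finset.sum_mul]
            exact Finset.sum_comm
        _ ≤ ∑ p ∈ P, B * Fintype.card (Fin n → Fin u) := Finset.sum_le_sum hbad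
        _ = ∑ _h : Fin n → Fin u, P.card * B := by
            simp only [Finset.sum_const, smul_eq_mul, Finset.card_univ]
            ring)
  refine ⟨ext h, fun x => ?_, ?_⟩
  · simp only [ext, Finset.mem_Icc]
    split_ifs with hx
    · have := (h ⟨x, hx⟩).2
      omega
    · omega
  · convert hh using 3

theorem sum_min_sub_mul (X u d : ℕ) :
    ∑ r : Fin d, min u (X - r * u) = min X (d * u) := by
  induction d with
  | zero => simp
  | succ d ih =>
    rw [Fin.sum_univ_castSucc]
    simp only [Fin.val_castSucc, Fin.val_last]
    rw [ih, Nat.add_mul]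
    omega

/-- A family of sets can be padded with further subsets of `[u]` to a given total size. -/
theorem exists_padding {k m u N : ℕ} (T : Fin k → Finset ℕ) (hT : ∀ i, T i ⊆ Finset.Icc 1 u)
    (hk : k ≤ m) (hN : total T ≤ N) (hm : N ≤ (m - k) * u) :
    ∃ S : Fin m → Finset ℕ, (∀ i, S i ⊆ Finset.Icc 1 u) ∧ total S = N ∧
      ∀ i : Fin k, S (Fin.castLE hk i) = T i := by
  obtain ⟨d, rfl⟩ := Nat.exists_eq_add_of_le hk
  -- Greedy filling: each new set takes u of the missing elements until none are missing; truncated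
  -- subtraction makes the rest empty.
  let R : Fin d → Finset ℕ := fun r => Finset.Icc 1 (min u (N - total T - r * u))
  refine ⟨Fin.append T R, fun i => ?_, ?_, fun i => Fin.append_left T R i⟩
  · refine Fin.addCases (fun i => ?_) (fun i => ?_) i
    · rw [Fin.append_left]; exact hT i
    · rw [Fin.append_right]
      exact Finset.Icc_subset_Icc_right (min_le_left _ _)
  · have h1 : total (Fin.append T R) = total T + total R := by
      simp only [total, Fin.sum_univ_add, Fin.append_left, Fin.append_right]
    have h2 : total R = min (N - total T) (d * u) := by
      rw [← sum_min_sub_mul]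
      simp [total, R]
    rw [Nat.add_sub_cancel_left] at hm
    omega

/-- Markov's inequality for the set sizes. -/
theorem card_filter_lt_mul_le {m : ℕ} (S : Fin m → Finset ℕ) (τ : ℕ) :
    (Finset.univ.filter fun i => τ < (S i).card).card * (τ + 1) ≤ total S := by
  calc _ = ∑ i ∈ Finset.univ.filter fun i => τ < (S i).card, (τ + 1) := by
        rw [Finset.sum_const, smul_eq_mul]
    _ ≤ ∑ i ∈ Finset.univ.filter fun i => τ < (S i).card, (S i).card :=
        Finset.sum_le_sum fun i hi => (Finset.mem_filter.1 hi).2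
    _ ≤ total S := Finset.sum_le_sum_of_subset (Finset.filter_subset _ _)

/-- A data structure for families of `m'` subsets of `[u]` yields one for arbitrary families: scan
the sets of at most `τ` elements, and hash the others into `[u]`. -/
theorem exists_reduced_data (A : DataStructure) {N m m' u sp T τ : ℕ} (H : ℕ)
    (S : Fin m → Finset ℕ)
    (hm : m ≤ N) (hN : total S = N) (hu : 1 ≤ u)
    (hA : ∀ S' : Fin m' → Finset ℕ, (∀ i, S' i ⊆ Finset.Icc 1 u) → total S' = N →
      A.Handles S' sp T)
    (hsp : sp ≤ N ^ 2) (hτN : τ ≤ N) (hm'N : m' ≤ N)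
    (hm' : ∀ k, k * (τ + 1) ≤ N → k ≤ m' ∧ N ≤ (m' - k) * u) :
    ∃ e k g : ℕ, k * (τ + 1) ≤ N ∧ g * (H + 1) ≤ N ∧ e * u ≤ 2 * g * k * u + k ^ 2 * H ^ 2 ∧
      ∃ D : List ℕ, D.length ≤ 8 * (3 * N + 2 * e + sp + 4) ∧
        (∀ x ∈ D, x < (N + 2) ^ (A.wordExp + 8)) ∧
        ∀ i j : Fin m, ∃ t ≤ (τ + 2) * (12 * Nat.log 2 (N + N ^ 2) + 60) + 5 * T, ∃ s,
          Exec ((N + 2) ^ (A.wordExp + 8)) D (combine A.query) (.init i j) t s ∧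
          s.reg 0 = if Disjoint (S i) (S j) then 1 else 0 := by
  classical
  let big := Finset.univ.filter fun i => τ < (S i).card
  let heavy := big.filter fun i => H < (S i).card
  have hbig : big.card * (τ + 1) ≤ N := hN ▸ card_filter_lt_mul_le S τ
  have hheavy : heavy.card * (H + 1) ≤ N := by
    refine le_trans (Nat.mul_le_mul_right _ (Finset.card_le_card ?_))
      (hN ▸ card_filter_lt_mul_le S H)
    exact Finset.filter_subset_filter _ (Finset.subset_univ _)
  let P := (big ×ˢ big).filter fun p => Disjoint (S p.1) (S p.2) ∧
    (S p.1).card ≤ H ∧ (S p.2).card ≤ H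
  obtain ⟨h, hhu, hh⟩ := exists_hash S hu P (B := H ^ 2)
    (fun p hp => (Finset.mem_filter.1 hp).2.1) (fun p hp => by
      have := (Finset.mem_filter.1 hp).2.2
      rw [sq]
      exact Nat.mul_le_mul this.1 this.2)
  let E := (big ×ˢ big).filter fun p => Disjoint (S p.1) (S p.2) ∧
    ¬ Disjoint ((S p.1).image h) ((S p.2).image h)
  have hE : E.card * u ≤ 2 * heavy.card * big.card * u + big.card ^ 2 * H ^ 2 := by
    -- Pairs with a heavy set are charged in full, whether or not hashing spoils them; the remaining
    -- ones are controlled by `exists_hash`.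
    have hsub : E ⊆ (heavy ×ˢ big ∪ big ×ˢ heavy) ∪
        P.filter fun p => ¬ Disjoint ((S p.1).image h) ((S p.2).image h) := by
      intro p hp
      simp only [E, Finset.mem_filter, Finset.mem_product] at hp
      simp only [P, heavy, Finset.mem_union, Finset.mem_filter, Finset.mem_product]
      by_cases h1 : (S p.1).card ≤ H
      · by_cases h2 : (S p.2).card ≤ H
        · exact .inr ⟨⟨hp.1, hp.2.1, h1, h2⟩, hp.2.2⟩
        · exact .inl (.inr ⟨hp.1.1, hp.1.2, not_le.1 h2⟩)
      · exact .inl (.inl ⟨⟨hp.1.1, not_le.1 h1⟩, hp.1.2⟩)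
    have h1 : E.card ≤ heavy.card * big.card + big.card * heavy.card +
        (P.filter fun p => ¬ Disjoint ((S p.1).image h) ((S p.2).image h)).card := by
      refine (Finset.card_le_card hsub).trans ((Finset.card_union_le _ _).trans ?_)
      gcongr
      refine (Finset.card_union_le _ _).trans ?_
      rw [Finset.card_product, Finset.card_product]
    have h2 : P.card ≤ big.card ^ 2 := by
      rw [sq, ← Finset.card_product]
      exact Finset.card_le_card (Finset.filter_subset _ _)
    calc E.card * u ≤ _ := Nat.mul_le_mul_right u h1
      _ = 2 * heavy.card * big.card * u +
        (P.filter fun p => ¬ Disjoint ((S p.1).image h) ((S p.2).image h)).card * u := by ring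
      _ ≤ 2 * heavy.card * big.card * u + P.card * H ^ 2 := by gcongr
      _ ≤ _ := by gcongr
  obtain ⟨hk, hpad⟩ := hm' _ hbig
  let names := big.equivFin
  obtain ⟨S', hS'u, hS'N, hS'⟩ := exists_padding
    (fun r : Fin big.card => (S (names.symm r)).image h) (N := N) (u := u)
    (fun r x hx => by
      obtain ⟨y, -, rfl⟩ := Finset.mem_image.1 hx
      exact hhu y) hk (by
      calc total (fun r : Fin big.card => (S (names.symm r)).image h)
          ≤ ∑ r, (S (names.symm r)).card := Finset.sum_le_sum fun r _ => Finset.card_image_le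
        _ = ∑ i : big, (S i).card := Equiv.sum_comp names.symm fun i : big => (S i).card
        _ = ∑ i ∈ big, (S i).card := Finset.sum_coe_sort big fun i => (S i).card
        _ ≤ total S := Finset.sum_le_sum_of_subset (Finset.subset_univ _)
        _ = N := hN) hpad
  obtain ⟨hlen, hword, hquery⟩ := hA S' hS'u hS'N
  -- Padding to total size exactly N makes the word bound of `A` the same power of `N + 2` as for
  -- the original family.
  rw [hS'N] at hword hquery
  have hpow : (N + 2) ^ A.wordExp ≤ (N + 2) ^ (A.wordExp + 8) :=
    Nat.pow_le_pow_right (by omega) (by omega)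
  obtain ⟨D, hD1, hD2, hD3⟩ := exists_combined_data A.query S hm hN (w := A.wordExp + 8)
    (by omega) big hτN (fun i hi => by simpa [big] using hi) E hpow (hlen.trans hsp)
    (fun x hx => (hword x hx).trans_le hpow)
    (fun i => if hi : i ∈ big then (names ⟨i, hi⟩ : ℕ) else 0) (fun i => by
      have h1 : N + 2 ≤ (N + 2) ^ (A.wordExp + 8) := Nat.le_self_pow (by omega) _
      split_ifs with hi
      · have := (names ⟨i, hi⟩).2
        omega
      · omega) (T := T) (fun i hi j hj => by
      refine ⟨fun h => (Finset.mem_filter.1 h).2.1, fun hij => ?_⟩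
      obtain ⟨t, ht, s, hex, hs⟩ := hquery (Fin.castLE hk (names ⟨i, hi⟩))
        (Fin.castLE hk (names ⟨j, hj⟩))
      refine ⟨t, ht, s, by simpa [hi, hj] using hex, ?_⟩
      rw [hs, hS', hS', Equiv.symm_apply_apply, Equiv.symm_apply_apply]
      dsimp only
      have hiff : Disjoint ((S i).image h) ((S j).image h) ↔ Disjoint (S i) (S j) := by
        constructor
        · intro hd
          rw [Finset.disjoint_left] at hd ⊢
          exact fun x hx hx' => hd (Finset.mem_image_of_mem h hx) (Finset.mem_image_of_mem h hx')
        · intro hd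
          by_contra hd'
          exact hij (Finset.mem_filter.2 ⟨Finset.mem_product.2 ⟨hi, hj⟩, hd, hd'⟩)
      by_cases hd : Disjoint (S i) (S j)
      · rw [if_pos hd, if_pos (hiff.2 hd)]
      · rw [if_neg hd, if_neg (mt hiff.1 hd)])
  exact ⟨E.card, big.card, heavy.card, hbig, hheavy, hE, D, hD1.trans (by omega), hD2, hD3⟩

end SetDisjointness

/-! ### Parameters and asymptotics -/

namespace SetDisjointness

open WordRAM

/-- Preprocessing is unrestricted, so it may choose valid data for each family separately; only the
query program and word exponent must be uniform. -/
theorem exists_solves (q : Prog) (w : ℕ) (space time : ℕ → ℕ)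
    (h : ∀ (N m : ℕ) (S : Fin m → Finset ℕ), m ≤ N → total S = N →
      ∃ D : List ℕ, D.length ≤ space N ∧ (∀ x ∈ D, x < (N + 2) ^ w) ∧
        ∀ i j : Fin m, ∃ t ≤ time N, ∃ s, Exec ((N + 2) ^ w) D q (.init i j) t s ∧
          s.reg 0 = if Disjoint (S i) (S j) then 1 else 0) :
    ∃ A : DataStructure, A.Solves space time := by
  classical
  let good : {m : ℕ} → (Fin m → Finset ℕ) → List ℕ → Prop := fun {m} S D =>
    D.length ≤ space (total S) ∧ (∀ x ∈ D, x < (total S + 2) ^ w) ∧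
      ∀ i j : Fin m, ∃ t ≤ time (total S), ∃ s, Exec ((total S + 2) ^ w) D q (.init i j) t s ∧
        s.reg 0 = if Disjoint (S i) (S j) then 1 else 0
  refine ⟨⟨fun S => if h : ∃ D, good S D then h.choose else [], q, w⟩, ?_⟩
  rintro _ m S hm rfl
  have hex : ∃ D, good S D := h _ m S hm rfl
  have hspec := hex.choose_spec
  simp only [DataStructure.Handles, dif_pos hex]
  exact hspec

/-- The estimates for the parameters of the reduction. -/
theorem parameter_bounds {N u : ℕ} {ε θ α : ℝ} (hα : 0 < α) (hαθ : 5 * α ≤ θ) (hαε : 2 * α ≤ ε)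
    (hα4 : 4 * α ≤ 1) (hu : 1 ≤ u) (huN : u ≤ N) (hlarge : 4 ≤ (u : ℝ) ^ α) :
    ∃ m' : ℕ, InRange ε u N m' ∧
      (∀ k, k * (⌊(u : ℝ) ^ (1 / 2 - α)⌋₊ + 1) ≤ N → k ≤ m' ∧ N ≤ (m' - k) * u) ∧
      (m' : ℝ) ^ (2 - θ) ≤ (N : ℝ) ^ 2 / (u : ℝ) ^ (1 - 3 / 2 * α) := by
  set U : ℝ := (u : ℝ) with hU
  set X : ℝ := (N : ℝ) with hX
  have hU1 : 1 ≤ U := by rw [hU]; exact_mod_cast hu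
  have hU0 : 0 < U := by linarith
  have hUX : U ≤ X := by rw [hU, hX]; exact_mod_cast huN
  set x := U ^ α with hx
  set r := U ^ (1 / 2 : ℝ) with hr
  have hr0 : 0 < r := Real.rpow_pos_of_pos hU0 _
  have hr1 : 1 ≤ r := Real.one_le_rpow hU1 (by norm_num)
  have hrr : r * r = U := by
    rw [hr, ← Real.rpow_add hU0]; norm_num
  set z := X / r with hz
  have hzr : r ≤ z := by
    rw [hz, le_div_iff₀ hr0, hrr]; exact hUX
  have hXz : X = z * r := by rw [hz]; field_simp
  have e1 : U ^ (1 / 2 - α) = r / x := Real.rpow_sub hU0 _ _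
  have e2 : U ^ (1 / 2 - 2 * α) = r / x ^ 2 := by
    rw [Real.rpow_sub hU0, mul_comm 2 α, Real.rpow_mul hU0.le, Real.rpow_two]
  have hx0 : 0 < x := by linarith
  set y := X / U ^ (1 / 2 - 2 * α) with hy
  have hyz : y = z * x ^ 2 := by rw [hy, e2, hz]; field_simp
  set m' := ⌊y⌋₊ with hm'
  have hy0 : 0 ≤ y := by rw [hyz]; positivity
  have hm1 : (m' : ℝ) ≤ y := Nat.floor_le hy0
  have hm2 : y < m' + 1 := Nat.lt_floor_add_one y
  have hz1 : 1 ≤ z := hr1.trans hzr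
  have hzx : 16 * z ≤ z * x ^ 2 := by
    have : 16 ≤ x ^ 2 := by nlinarith
    nlinarith
  have hzm : z ≤ m' := by linarith
  refine ⟨m', ⟨hzm, hm1.trans ?_, ?_⟩, ?_, ?_⟩
  · rw [hy]
    have : U ^ (1 / 2 - ε) ≤ U ^ (1 / 2 - 2 * α) :=
      Real.rpow_le_rpow_of_exponent_le hU1 (by linarith)
    have := Real.rpow_pos_of_pos hU0 (1 / 2 - ε)
    gcongr
  · have h1 : y ≤ X := div_le_self (by linarith)
      (Real.one_le_rpow hU1 (by linarith))
    exact Nat.cast_le.1 (hm1.trans h1)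
  · intro k hk
    have h1 : U ^ (1 / 2 - α) < ⌊U ^ (1 / 2 - α)⌋₊ + 1 := Nat.lt_floor_add_one _
    have h2 : (k : ℝ) * (⌊U ^ (1 / 2 - α)⌋₊ + 1) ≤ X := by rw [hX]; exact_mod_cast hk
    have h3 : (k : ℝ) ≤ z * x := by
      have h4 : (k : ℝ) * (r / x) ≤ X := by
        rw [← e1]
        exact le_trans (by gcongr) h2
      rw [hXz, mul_div_assoc', div_le_iff₀ hx0] at h4
      have h5 : (k : ℝ) * r ≤ (z * x) * r := by linarith
      exact le_of_mul_le_mul_right h5 hr0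
    -- There are at most zx big sets, while m' exceeds zx² - 1; as x ≥ 4, at least z sets remain for
    -- padding, with room for zU ≥ N elements.
    have h4 : (k : ℝ) + z ≤ m' := by nlinarith
    have hkm : k ≤ m' := by
      have : (k : ℝ) ≤ m' := by linarith
      exact_mod_cast this
    refine ⟨hkm, ?_⟩
    have h5 : X ≤ (m' - k) * U := by
      calc X = z * r := hXz
        _ ≤ z * U := by
          rw [← hrr]
          nlinarith
        _ ≤ (m' - k) * U := by gcongr; linarith
    have h6 : (N : ℝ) ≤ ((m' - k : ℕ) : ℝ) * (u : ℝ) := by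
      rw [Nat.cast_sub hkm]; exact h5
    exact_mod_cast h6
  · have hm0 : (0 : ℝ) < m' := by linarith
    have hθ : 0 ≤ θ := by linarith
    calc (m' : ℝ) ^ (2 - θ) = (m' : ℝ) ^ 2 * (m' : ℝ) ^ (-θ) := by
          rw [sub_eq_add_neg, Real.rpow_add hm0]; norm_num
      _ ≤ y ^ 2 * r ^ (-θ) := by
          have : (m' : ℝ) ^ (-θ) ≤ r ^ (-θ) :=
            Real.rpow_le_rpow_of_nonpos hr0 (hzr.trans hzm) (by linarith)
          gcongr
      _ = X ^ 2 / U ^ (1 - 4 * α + θ / 2) := by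
          have h1 : r ^ (-θ) = (U ^ (θ / 2))⁻¹ := by
            rw [hr, ← Real.rpow_mul hU0.le, ← Real.rpow_neg hU0.le]; congr 1; ring
          have h2 : U ^ (1 - 4 * α + θ / 2) = (U ^ (1 / 2 - 2 * α)) ^ 2 * U ^ (θ / 2) := by
            rw [Real.rpow_add hU0, ← Real.rpow_natCast, ← Real.rpow_mul hU0.le]
            congr 2; push_cast; ring
          rw [h1, h2, hy]
          field_simp
      -- The gain `U ^ (θ / 2)`, from m' ≥ U^(1/2), outweighs the loss `U ^ (4 * α)` because 5α ≤ θ.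
      _ ≤ X ^ 2 / U ^ (1 - 3 / 2 * α) := by
          have h1 : U ^ (1 - 3 / 2 * α) ≤ U ^ (1 - 4 * α + θ / 2) :=
            Real.rpow_le_rpow_of_exponent_le hU1 (by linarith)
          have := Real.rpow_pos_of_pos hU0 (1 - 3 / 2 * α)
          gcongr

/-- The heavy threshold α/4 balances two errors: heavy pairs contribute gk ≤ N²/U^(1-5α/4), and
hashing contributes k²H²/U ≤ N²/U^(1-3α/2). -/
theorem exception_bound {N u e k g : ℕ} {α : ℝ} (hα : 0 < α) (hα4 : 4 * α ≤ 1) (hu : 1 ≤ u)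
    (hk : k * (⌊(u : ℝ) ^ (1 / 2 - α)⌋₊ + 1) ≤ N)
    (hg : g * (⌊(u : ℝ) ^ (1 / 2 - α / 4)⌋₊ + 1) ≤ N)
    (he : e * u ≤ 2 * g * k * u + k ^ 2 * ⌊(u : ℝ) ^ (1 / 2 - α / 4)⌋₊ ^ 2) :
    (e : ℝ) ≤ 3 * ((N : ℝ) ^ 2 / (u : ℝ) ^ (1 - 3 / 2 * α)) := by
  set U : ℝ := (u : ℝ) with hU
  have hU1 : 1 ≤ U := by rw [hU]; exact_mod_cast hu
  have hU0 : 0 < U := by linarith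
  have aux : ∀ (a : ℝ) (k : ℕ), k * (⌊U ^ a⌋₊ + 1) ≤ N → (k : ℝ) ≤ N / U ^ a := by
    intro a k hk
    have h2 : (k : ℝ) * (⌊U ^ a⌋₊ + 1) ≤ N := by exact_mod_cast hk
    rw [le_div_iff₀ (Real.rpow_pos_of_pos hU0 _)]
    exact le_trans (by gcongr; exact (Nat.lt_floor_add_one _).le) h2
  have hk' := aux _ k hk
  have hg' := aux _ g hg
  have hH : (⌊U ^ (1 / 2 - α / 4)⌋₊ : ℝ) ≤ U ^ (1 / 2 - α / 4) :=
    Nat.floor_le (Real.rpow_pos_of_pos hU0 _).le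
  have he' : (e : ℝ) * U ≤ 2 * g * k * U + k ^ 2 * (⌊U ^ (1 / 2 - α / 4)⌋₊ : ℝ) ^ 2 := by
    rw [hU]; exact_mod_cast he
  set G := (N : ℝ) ^ 2 / U ^ (1 - 3 / 2 * α) with hG
  have h1 : (g : ℝ) * k ≤ G := by
    calc (g : ℝ) * k ≤ N / U ^ (1 / 2 - α / 4) * (N / U ^ (1 / 2 - α)) := by gcongr
      _ = N ^ 2 / U ^ (1 - 5 / 4 * α) := by
        rw [div_mul_div_comm, ← Real.rpow_add hU0, ← sq]; congr 2; ring
      _ ≤ G := by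
        have h1 : U ^ (1 - 3 / 2 * α) ≤ U ^ (1 - 5 / 4 * α) :=
          Real.rpow_le_rpow_of_exponent_le hU1 (by linarith)
        have := Real.rpow_pos_of_pos hU0 (1 - 3 / 2 * α)
        rw [hG]
        gcongr
  have h2 : (k : ℝ) ^ 2 * (⌊U ^ (1 / 2 - α / 4)⌋₊ : ℝ) ^ 2 ≤ G * U := by
    calc (k : ℝ) ^ 2 * (⌊U ^ (1 / 2 - α / 4)⌋₊ : ℝ) ^ 2
        ≤ (N / U ^ (1 / 2 - α)) ^ 2 * (U ^ (1 / 2 - α / 4)) ^ 2 := by gcongr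
      _ = G * U := by
        have e1 : (U ^ (1 / 2 - α)) ^ 2 = U ^ (1 - 2 * α) := by
          rw [← Real.rpow_natCast, ← Real.rpow_mul hU0.le]; congr 1; push_cast; ring
        have e2 : (U ^ (1 / 2 - α / 4)) ^ 2 = U ^ (1 - α / 2) := by
          rw [← Real.rpow_natCast, ← Real.rpow_mul hU0.le]; congr 1; push_cast; ring
        have e3 : U ^ (1 - α / 2) * U ^ (1 - 3 / 2 * α) = U * U ^ (1 - 2 * α) := by
          rw [← Real.rpow_add hU0, ← Real.rpow_one_add' hU0.le (by linarith)]
          congr 1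
          ring
        rw [div_pow, e1, e2, hG, div_mul_eq_mul_div, div_mul_eq_mul_div, div_eq_div_iff
          (Real.rpow_pos_of_pos hU0 _).ne' (Real.rpow_pos_of_pos hU0 _).ne', mul_assoc, mul_assoc,
          e3]
  have h3 : (e : ℝ) * U ≤ 3 * G * U := by nlinarith
  exact le_of_mul_le_mul_right h3 hU0

theorem log_two_le (N : ℕ) (hN : 3 ≤ N) : (Nat.log 2 (N + N ^ 2) : ℝ) ≤ 5 * Real.log N := by
  have h1 : (Nat.log 2 (N + N ^ 2) : ℝ) ≤ Real.logb 2 ((N + N ^ 2 : ℕ) : ℝ) :=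
    Real.natLog_le_logb _ _
  have h2 : ((N + N ^ 2 : ℕ) : ℝ) ≤ (N : ℝ) ^ 3 := by
    have : N + N ^ 2 ≤ N ^ 3 := by nlinarith [sq_nonneg N]
    exact_mod_cast this
  have hN0 : (0 : ℝ) < N := by positivity
  have hlog : 0 ≤ Real.log N := Real.log_natCast_nonneg N
  have h3 : Real.logb 2 ((N + N ^ 2 : ℕ) : ℝ) ≤ Real.logb 2 ((N : ℝ) ^ 3) :=
    Real.logb_le_logb_of_le (by norm_num) (by positivity) h2
  refine h1.trans (h3.trans ?_)
  rw [Real.logb, Real.log_pow, div_le_iff₀ (Real.log_pos (by norm_num))]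
  have := Real.log_two_gt_d9
  push_cast
  nlinarith

/-- Diagonal choice: at N take θ = 1/(k+1) for the largest k ≤ N whose threshold `f k` is at most N.
Such a k exists once N ≥ `f 0`. -/
theorem exists_tendsto_of_forall_eventually {P : ℝ → ℕ → Prop}
    (h : ∀ θ > 0, ∀ᶠ N in atTop, P θ N) :
    ∃ η : ℕ → ℝ, Tendsto η atTop (𝓝 0) ∧ ∀ᶠ N in atTop, P (η N) N := by
  have h' : ∀ k : ℕ, ∃ f : ℕ, ∀ N ≥ f, P (1 / ((k : ℝ) + 1)) N := fun k =>
    eventually_atTop.1 (h _ (by positivity))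
  choose f hf using h'
  let κ : ℕ → ℕ := fun N => Nat.findGreatest (fun k => f k ≤ N) N
  refine ⟨fun N => 1 / ((κ N : ℝ) + 1), ?_, ?_⟩
  · refine tendsto_one_div_add_atTop_nhds_zero_nat.comp (tendsto_atTop_atTop.2 fun k => ?_)
    exact ⟨max k (f k), fun N hN => Nat.le_findGreatest (le_of_max_le_left hN)
      (le_of_max_le_right hN)⟩
  · refine eventually_atTop.2 ⟨f 0, fun N hN => hf _ N ?_⟩
    exact Nat.findGreatest_spec (P := fun k => f k ≤ N) (Nat.zero_le N) hN

theorem eventually_log_pow_lt {b c : ℝ} (hb : 0 < b) (hc : 0 < c) (k : ℕ) :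
    ∀ᶠ N : ℕ in atTop, Real.log N ^ k < c * (N : ℝ) ^ b := by
  have h := (isLittleO_log_rpow_rpow_atTop (k : ℝ) hb).comp_tendsto
    (tendsto_natCast_atTop_atTop (R := ℝ))
  filter_upwards [h.bound (half_pos hc), eventually_ge_atTop 1] with N hN h1
  have hN0 : (0 : ℝ) < N := by exact_mod_cast h1
  have hpos : 0 < (N : ℝ) ^ b := Real.rpow_pos_of_pos hN0 _
  simp only [Function.comp, Real.rpow_natCast, Real.norm_eq_abs] at hN
  rw [abs_of_pos hpos] at hN
  have := le_abs_self (Real.log N ^ k)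
  nlinarith

theorem eventually_exists_large (hconj : StrongConjecture) {ε δ : ℝ} (hε : 0 < ε) (hδ : 0 < δ)
    (u : ℕ → ℕ) (hu : ∀ N : ℕ, (N : ℝ) ^ δ ≤ u N ∧ u N ≤ N)
    (A : DataStructure) (space time : ℕ → ℕ → ℕ) (hA : A.SolvesBounded u ε space time)
    {θ : ℝ} (hθ : 0 < θ) :
    ∀ᶠ N : ℕ in atTop, ∃ m : ℕ, InRange ε (u N) N m ∧
      ((m : ℝ) ^ (2 - θ) ≤ space N m ∨ (u N : ℝ) ^ (1 / 2 - θ) ≤ time N m) := by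
  classical
  by_contra hcon
  -- 5α ≤ θ brings the given space below G and the given time below τ, 2α ≤ ε keeps m' in range, and
  -- 4α ≤ 1 keeps the exponents nonnegative.
  obtain ⟨α, hα, hαθ, hαε, hα4⟩ : ∃ α : ℝ, 0 < α ∧ 5 * α ≤ θ ∧ 2 * α ≤ ε ∧ 4 * α ≤ 1 := by
    refine ⟨min (θ / 5) (min (ε / 2) (1 / 4)), by positivity, ?_, ?_, ?_⟩
    · linarith [min_le_left (θ / 5) (min (ε / 2) (1 / 4))]
    · linarith [min_le_right (θ / 5) (min (ε / 2) (1 / 4)), min_le_left (ε / 2) (1 / 4 : ℝ)]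
    · linarith [min_le_right (θ / 5) (min (ε / 2) (1 / 4)), min_le_right (ε / 2) (1 / 4 : ℝ)]
  let U : ℕ → ℝ := fun N => u N
  let G : ℕ → ℝ := fun N => (N : ℝ) ^ 2 / U N ^ (1 - 3 / 2 * α)
  let Bad : ℕ → Prop := fun N => 3 ≤ N ∧ 4 ≤ U N ^ α ∧ ∀ m, InRange ε (u N) N m →
    (space N m : ℝ) < (m : ℝ) ^ (2 - θ) ∧ (time N m : ℝ) < U N ^ (1 / 2 - θ)
  have hU1 : ∀ N, 3 ≤ N → 1 ≤ U N := fun N hN =>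
    (Real.one_le_rpow (by exact_mod_cast (by omega : 1 ≤ N)) hδ.le).trans (hu N).1
  have hUδ : ∀ a : ℝ, 0 ≤ a → ∀ N : ℕ, (N : ℝ) ^ (δ * a) ≤ U N ^ a := by
    intro a ha N
    rw [Real.rpow_mul (Nat.cast_nonneg N)]
    exact Real.rpow_le_rpow (by positivity) (hu N).1 ha
  have hbad : ∃ᶠ N in atTop, Bad N := by
    have h1 : ∀ᶠ N : ℕ in atTop, 4 ≤ U N ^ α := by
      have := (tendsto_rpow_atTop (mul_pos hδ hα)).comp (tendsto_natCast_atTop_atTop (R := ℝ))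
      filter_upwards [this.eventually_ge_atTop 4] with N hN
      exact hN.trans (hUδ α hα.le N)
    refine ((not_eventually.1 hcon).and_eventually (h1.and (eventually_ge_atTop 3))).mono ?_
    rintro N ⟨hN, h4, h3⟩
    refine ⟨h3, h4, fun m hm => ?_⟩
    push Not at hN
    exact hN m hm
  let lg : ℕ → ℕ := fun N => 12 * Nat.log 2 (N + N ^ 2) + 60
  -- 112 = 8(3 + 6 + 1 + 4), from N ≤ G, e ≤ 3G, given space ≤ G and 1 ≤ G.
  let space' : ℕ → ℕ := fun N => if Bad N then ⌊112 * G N⌋₊ else 8 * (3 * N + 4)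
  let τ : ℕ → ℕ := fun N => ⌊U N ^ (1 / 2 - α)⌋₊
  let time' : ℕ → ℕ := fun N => if Bad N then (τ N + 2) * lg N + 5 * τ N else (N + 2) * lg N
  have hG : ∀ N : ℕ, 3 ≤ N → (N : ℝ) ≤ G N ∧ G N ≤ (N : ℝ) ^ 2 := by
    intro N hN
    have h1 := hU1 N hN
    have hN0 : (0 : ℝ) < N := by positivity
    have hpos := Real.rpow_pos_of_pos (by linarith : 0 < U N) (1 - 3 / 2 * α)
    constructor
    · simp only [G]
      rw [le_div_iff₀ hpos, sq]
      gcongr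
      calc U N ^ (1 - 3 / 2 * α) ≤ U N ^ (1 : ℝ) :=
            Real.rpow_le_rpow_of_exponent_le h1 (by linarith)
        _ = U N := Real.rpow_one _
        _ ≤ N := Nat.cast_le.2 (hu N).2
    · exact div_le_self (by positivity) (Real.one_le_rpow h1 (by linarith))
  obtain ⟨A', hA'⟩ : ∃ A' : DataStructure, A'.Solves space' time' := by
    refine exists_solves (combine A.query) (A.wordExp + 8) space' time' fun N m S hm hN => ?_
    by_cases hB : Bad N
    · obtain ⟨h3, h4, hlow⟩ := hB
      have h1 := hU1 N h3
      have hu1 : 1 ≤ u N := Nat.one_le_cast.1 (show (1 : ℝ) ≤ (u N : ℝ) from h1)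
      obtain ⟨m', hm', hk, hsp⟩ := parameter_bounds (N := N) hα hαθ hαε hα4 hu1 (hu N).2 h4
      obtain ⟨hs, ht⟩ := hlow m' hm'
      obtain ⟨hG1, hG2⟩ := hG N h3
      have hsG : (space N m' : ℝ) ≤ G N := hs.le.trans hsp
      have htτ : time N m' ≤ τ N := Nat.le_floor (ht.le.trans
        (Real.rpow_le_rpow_of_exponent_le h1 (by linarith)))
      have hτN : τ N ≤ N := by
        refine Nat.floor_le_of_le ?_
        calc U N ^ (1 / 2 - α) ≤ U N ^ (1 : ℝ) :=
              Real.rpow_le_rpow_of_exponent_le h1 (by linarith)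
          _ = U N := Real.rpow_one _
          _ ≤ N := Nat.cast_le.2 (hu N).2
      obtain ⟨e, k, g, hk', hg', he', D, hD1, hD2, hD3⟩ := exists_reduced_data A
        (⌊U N ^ (1 / 2 - α / 4)⌋₊) S hm hN hu1 (hA N m' · hm')
        (by exact_mod_cast hsG.trans hG2) hτN hm'.2.2 hk
      have heG : (e : ℝ) ≤ 3 * G N := exception_bound hα hα4 hu1 hk' hg' he'
      refine ⟨D, ?_, hD2, fun i j => ?_⟩
      · simp only [space', if_pos (show Bad N from ⟨h3, h4, hlow⟩)]
        refine Nat.le_floor ?_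
        have hD1' : (D.length : ℝ) ≤ 8 * (3 * N + 2 * e + space N m' + 4) := by
          exact_mod_cast hD1
        have : (3 : ℝ) ≤ N := by exact_mod_cast h3
        linarith
      · obtain ⟨t, htt, s, hex⟩ := hD3 i j
        refine ⟨t, htt.trans ?_, s, hex⟩
        simp only [time', if_pos (show Bad N from ⟨h3, h4, hlow⟩), lg]
        omega
    -- The conjecture concerns structures correct at every N. At the other N no set counts as big,
    -- and the same program answers by scanning.
    · have hcard : ∀ i, (S i).card ≤ N := fun i => hN ▸
        Finset.single_le_sum (f := fun i => (S i).card) (fun _ _ => Nat.zero_le _)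
          (Finset.mem_univ i)
      obtain ⟨D, hD1, hD2, hD3⟩ := exists_combined_data A.query S hm hN (w := A.wordExp + 8)
        (by omega) ∅ le_rfl (fun i _ => hcard i) ∅ (D' := []) (W' := 0) (Nat.zero_le _) (by simp)
        (by simp) (fun _ => 0) (fun _ => by positivity) (T := 0) (by simp)
      refine ⟨D, ?_, hD2, fun i j => ?_⟩
      · simpa [space', if_neg hB] using hD1
      · simpa [time', if_neg hB, lg] using hD3 i j
  obtain ⟨c, k, hc, hev⟩ := hconj A' space' time' hA'
  have hlog := eventually_log_pow_lt (b := δ * (α / 2)) (by positivity)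
    (show 0 < c / (112 * 400 ^ 2) by positivity) (k + 2)
  -- Bad N occur infinitely often, so one of them lies beyond the thresholds of the conjectured
  -- bound and of the logarithm estimate.
  obtain ⟨N, hB, hN1, hN2⟩ := (hbad.and_eventually (hev.and hlog)).exists
  obtain ⟨h3, h4, -⟩ := id hB
  have h1 := hU1 N h3
  have hU0 : 0 < U N := by linarith
  have hN0 : (0 : ℝ) < N := by positivity
  have hlog1 : 1 ≤ Real.log N := by
    rw [Real.le_log_iff_exp_le hN0]
    have : (3 : ℝ) ≤ N := by exact_mod_cast h3
    linarith [Real.exp_one_lt_d9]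
  set ℓ := Real.log N with hℓ
  have hV1 : 1 ≤ U N ^ (1 / 2 - α) := Real.one_le_rpow h1 (by linarith)
  set V := U N ^ (1 / 2 - α) with hV
  have hτ : (τ N : ℝ) ≤ V := Nat.floor_le (by linarith)
  have htime : (time' N : ℝ) ≤ 400 * (V * ℓ) := by
    have hl : (lg N : ℝ) ≤ 120 * ℓ := by
      have := log_two_le N h3
      simp only [lg]
      push_cast
      linarith
    have e : (time' N : ℝ) = (τ N + 2) * lg N + 5 * τ N := by
      simp only [time', if_pos hB]
      push_cast
      ring
    rw [e]
    calc ((τ N : ℝ) + 2) * lg N + 5 * τ N ≤ (3 * V) * (120 * ℓ) + 5 * (V * ℓ) := by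
          have h2 : (τ N : ℝ) ≤ V * ℓ := hτ.trans (le_mul_of_one_le_right (by linarith) hlog1)
          have h3 : (τ N : ℝ) + 2 ≤ 3 * V := by linarith
          gcongr
      _ ≤ 400 * (V * ℓ) := by nlinarith
  have htime0 : (0 : ℝ) < time' N := by
    have : 0 < time' N := by simp only [time', if_pos hB, lg]; positivity
    exact_mod_cast this
  have hspace : (space' N : ℝ) ≤ 112 * G N := by
    simp only [space', if_pos hB]
    exact Nat.floor_le (by linarith [(hG N h3).1])
  -- The contradiction's margin: space times squared time falls short of N² by `U ^ (α / 2)`, up to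
  -- constants and logarithms.
  have hVG : G N * (V ^ 2 * U N ^ (α / 2)) = (N : ℝ) ^ 2 := by
    have e1 : V ^ 2 * U N ^ (α / 2) = U N ^ (1 - 3 / 2 * α) := by
      rw [hV, ← Real.rpow_natCast, ← Real.rpow_mul hU0.le, ← Real.rpow_add hU0]
      congr 1
      push_cast
      ring
    rw [e1]
    exact div_mul_cancel₀ _ (Real.rpow_pos_of_pos hU0 _).ne'
  have hGpos : 0 < G N := hN0.trans_le (hG N h3).1
  have key : c * (N : ℝ) ^ 2 ≤ 112 * G N * (ℓ ^ k * (400 * (V * ℓ)) ^ 2) := by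
    have h5 := hN1.trans hspace
    rw [div_le_iff₀ (by positivity), ← mul_div_assoc, div_le_iff₀ (by positivity)] at h5
    refine h5.trans ?_
    rw [mul_assoc]
    gcongr
  have hfin : c * U N ^ (α / 2) ≤ 112 * 400 ^ 2 * ℓ ^ (k + 2) := by
    rw [← hVG] at key
    have h6 : (c * U N ^ (α / 2)) * (G N * V ^ 2) ≤
        (112 * 400 ^ 2 * ℓ ^ (k + 2)) * (G N * V ^ 2) := by
      calc _ = c * (G N * (V ^ 2 * U N ^ (α / 2))) := by ring
        _ ≤ _ := key
        _ = _ := by ring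
    exact le_of_mul_le_mul_right h6 (by positivity)
  have h7 := hUδ (α / 2) (by positivity) N
  have h8 : c * (N : ℝ) ^ (δ * (α / 2)) ≤ 112 * 400 ^ 2 * ℓ ^ (k + 2) :=
    le_trans (by gcongr) hfin
  rw [div_mul_eq_mul_div, lt_div_iff₀ (by norm_num)] at hN2
  linarith

end SetDisjointness

theorem mainTheorem2 (hconj : SetDisjointness.StrongConjecture)
    (ε δ : ℝ) (hε : 0 < ε) (hδ : 0 < δ)
    (u : ℕ → ℕ) (hu : ∀ N : ℕ, (N : ℝ) ^ δ ≤ u N ∧ u N ≤ N)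
    (A : SetDisjointness.DataStructure) (space time : ℕ → ℕ → ℕ)
    (hA : A.SolvesBounded u ε space time) :
    ∃ η : ℕ → ℝ, Tendsto η atTop (𝓝 0) ∧
      ∀ᶠ N : ℕ in atTop, ∃ m : ℕ, SetDisjointness.InRange ε (u N) N m ∧
        ((m : ℝ) ^ (2 - η N) ≤ space N m ∨ (u N : ℝ) ^ (1 / 2 - η N) ≤ time N m) :=
  SetDisjointness.exists_tendsto_of_forall_eventually fun _ hθ =>
    SetDisjointness.eventually_exists_large hconj hε hδ u hu A space time hA hθ
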